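/- Consider the class of equations $$f(x)\,u_t=(D(u)\,u_x)_x+K(u)\,u_x ,\qquad (\ast)$$ where $f$ (on an open interval of $x$) and $D,K$ (on an open interval of $u$) are smooth, $f$ and $D$ vanish nowhere, and $(D_u,K_u)$ is not identically $(0,0)$. Let $W$ be a non-empty connected open subset of the part $f\neq0$, $D\neq0$ of the space $\mathbb R^6$ with coordinates $(t,x,u,f,D,K)$. An equivalence transformation of the class on $W$ is a smooth diffeomorphism $\varphi$ of $W$ onto its image, $(t,x,u,f,D,K)\mapsto(\tilde t,\tilde x,\tilde u,\tilde f,\tilde D,\tilde K)$, such that for every equation $(\ast)$ with coefficients $(f,D,K)$, near every point $(t,x,u)$ over which the graph of $(f(x),D(u),K(u))$ lies in $W$, substituting $f=f(x)$, $D=D(u)$, $K=K(u)$ in $\varphi$ gives a nonsingular point transformation of $(t,x,u)$ that turns this equation into an equation $\tilde f(\tilde x)\tilde u_{\tilde t}=(\tilde D(\tilde u)\tilde u_{\tilde x})_{\tilde x}+\tilde K(\tilde u)\tilde u_{\tilde x}$ of the class whose coefficients are the transformed values $\tilde f,\tilde D,\tilde K$. (The images of $t,x,u$ are allowed to depend on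 $f,D,K$.) The Lie algebra $A^{\rm equiv}$ of the equivalence group on $W$ consists of the smooth vector fields on $W$ whose local flows consist of equivalence transformations. Then: 1. On every such $W$, $$A^{\rm equiv}=\langle \partial_t,\ \partial_x,\ \partial_u,\ t\partial_t+f\partial_f,\ x\partial_x-2f\partial_f-K\partial_K,\ u\partial_u,\ f\partial_f+K\partial_K+D\partial_D\rangle ,$$ the real linear span of the restrictions to $W$ of these seven vector fields. 2. The equivalence transformations on $W$ are exactly the restrictions to $W$ of the elements of the group of transformations of $\mathbb R^6$ generated by the continuous transformations $$\tilde t=te^{\varepsilon_4}+\varepsilon_1,\quad \tilde x=xe^{\varepsilon_5}+\varepsilon_2,\quad \tilde u=ue^{\varepsilon_6}+\varepsilon_3,\quad \tilde f=fe^{\varepsilon_4-2\varepsilon_5+\varepsilon_7},\quad \tilde D=De^{\varepsilon_7},\quad \tilde K=Ke^{-\varepsilon_5+\varepsilon_7}$$ with $\varepsilon_1,\dots,\varepsilon_7\in\mathbb R$, and the four involutions that change the signs of the variables in the sets $\{t,D,K\}$, $\{x,K\}$, $\{u\}$ and $\{f,D,K\}$, respectively. -/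

import Mathlib

open scoped Topology ContDiff

noncomputable section

namespace DiffConv

/-- The space of the independent and dependent variables, with coordinates `(t, x, u)`. -/
abbrev Base : Type := ℝ × ℝ × ℝ

/-- The space of the variables together with the values of the arbitrary elements, with
coordinates `((t, x, u), (f, D, K))`. -/
abbrev Ext : Type := Base × (ℝ × ℝ × ℝ)

/-- The part `f ≠ 0`, `D ≠ 0` of the extended space, where the arbitrary elements take values. -/
def regular : Set Ext := {z | z.2.1 ≠ 0 ∧ z.2.2.1 ≠ 0}

/-- An equation `f(x) u_t = (D(u) u_x)_x + K(u) u_x` of the class: `f` is smooth and nowhere zero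
on an open interval `I`, `D` and `K` are smooth on an open interval `J`, `D` is nowhere zero
there, and `(D_u, K_u)` is not identically `(0, 0)`. -/
structure Equation where
  I : Set ℝ
  J : Set ℝ
  f : ℝ → ℝ
  D : ℝ → ℝ
  K : ℝ → ℝ
  isOpen_I : IsOpen I
  isOpen_J : IsOpen J
  isPreconnected_I : IsPreconnected I
  isPreconnected_J : IsPreconnected J
  smooth_f : ContDiffOn ℝ ∞ f I
  smooth_D : ContDiffOn ℝ ∞ D J
  smooth_K : ContDiffOn ℝ ∞ K J
  f_ne_zero : ∀ x ∈ I, f x ≠ 0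
  D_ne_zero : ∀ u ∈ J, D u ≠ 0
  nonlinear : ∃ u ∈ J, deriv D u ≠ 0 ∨ deriv K u ≠ 0

namespace Equation

/-- The points `(t, x, u)` at which the coefficients of the equation are defined. -/
def dom (θ : Equation) : Set Base := {p | p.2.1 ∈ θ.I ∧ p.2.2 ∈ θ.J}

/-- The graph of the arbitrary elements: `(t, x, u) ↦ ((t, x, u), (f(x), D(u), K(u)))`. -/
def lift (θ : Equation) (p : Base) : Ext := (p, (θ.f p.2.1, θ.D p.2.2, θ.K p.2.2))

/-- The function `v` of `(t, x)` satisfies the differential equation at the point `s = (t, x)`: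
`f(x) v_t = (D(v) v_x)_x + K(v) v_x`. -/
def HoldsAt (θ : Equation) (v : ℝ × ℝ → ℝ) (s : ℝ × ℝ) : Prop :=
  θ.f s.2 * deriv (fun t ↦ v (t, s.2)) s.1 =
    deriv (fun x ↦ θ.D (v (s.1, x)) * deriv (fun y ↦ v (s.1, y)) x) s.2
      + θ.K (v s) * deriv (fun y ↦ v (s.1, y)) s.2

end Equation

/-- The transformation of `(t, x, u)` induced by a transformation `φ` of the extended space when
the arbitrary elements are those of `θ`. It may depend on `θ`, unless `φ` is projectible. -/
def induced (φ : Ext → Ext) (θ : Equation) (p : Base) : Base := (φ (θ.lift p)).1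

/-- At the point `p`, the transformation `φ` maps the equation `θ` to the equation `θ'`:
the induced transformation of `(t, x, u)` is nonsingular at `p`, the values of the arbitrary
elements of `θ` are taken to those of `θ'`, and the change of variables turns the one
differential equation into the other. The last condition says that, for a function `v` whose graph
passes through `p` and a function `v'` whose graph is near the image of `p` the transform of the
graph of `v`, the function `v` satisfies `θ` at `p` if and only if `v'` satisfies `θ'` at the image
of `p` (so the prolongation of the transformation identifies the two equations as sets
of jets). -/
structure MapsEquationAt (φ : Ext → Ext) (θ θ' : Equation) (p : Base) : Prop where
  nonsingular : Function.Bijective (fderiv ℝ (induced φ θ) p)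
  mem_dom : induced φ θ p ∈ θ'.dom
  map_lift : φ (θ.lift p) = θ'.lift (induced φ θ p)
  holds_iff : ∀ v v' : ℝ × ℝ → ℝ,
    v (p.1, p.2.1) = p.2.2 →
    ContDiffAt ℝ ∞ v (p.1, p.2.1) →
    ContDiffAt ℝ ∞ v' ((induced φ θ p).1, (induced φ θ p).2.1) →
    (∀ᶠ s in 𝓝 (p.1, p.2.1),
      v' ((induced φ θ (s.1, s.2, v s)).1, (induced φ θ (s.1, s.2, v s)).2.1) =
        (induced φ θ (s.1, s.2, v s)).2.2) →
    (θ.HoldsAt v (p.1, p.2.1) ↔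
      θ'.HoldsAt v' ((induced φ θ p).1, (induced φ θ p).2.1))

/-- `φ` is, on the open set `W`, an equivalence transformation of the class: a local diffeomorphism
of the space of `(t, x, u, f, D, K)` which maps every equation of the class, near every point
over which the graph of its arbitrary elements lies in `W`, to an equation of the class. -/
structure IsEquivalence (φ : Ext → Ext) (W : Set Ext) : Prop where
  smooth : ContDiffOn ℝ ∞ φ W
  injOn : Set.InjOn φ W
  bijective_fderiv : ∀ z ∈ W, Function.Bijective (fderiv ℝ φ z)
  maps_class : ∀ (θ : Equation) (p : Base), p ∈ θ.dom → θ.lift p ∈ W →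
    ∃ θ' : Equation, ∀ᶠ q in 𝓝 p, MapsEquationAt φ θ θ' q

/-- The smooth vector field `Q` on the open set `W` belongs to the Lie algebra of the equivalence
group: the transformations of its local flow are equivalence transformations. A vector field
`ξ^t ∂_t + ξ^x ∂_x + η ∂_u + π^f ∂_f + π^D ∂_D + π^K ∂_K` is identified with the map
`((ξ^t, ξ^x, η), (π^f, π^D, π^K))`. -/
structure IsInfinitesimalEquivalence (Q : Ext → Ext) (W : Set Ext) : Prop where
  smooth : ContDiffOn ℝ ∞ Q W
  exists_flow : ∀ z₀ ∈ W, ∃ V : Set Ext, IsOpen V ∧ z₀ ∈ V ∧ V ⊆ W ∧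
    ∃ r : ℝ, 0 < r ∧ ∃ Φ : ℝ → Ext → Ext,
      (∀ z ∈ V, Φ 0 z = z) ∧
      (∀ z ∈ V, ∀ ε : ℝ, |ε| < r → Φ ε z ∈ W ∧ HasDerivAt (fun s ↦ Φ s z) (Q (Φ ε z)) ε) ∧
      (∀ ε : ℝ, |ε| < r → IsEquivalence (Φ ε) V)

/-- The vector fields `∂_t`, `∂_x`, `∂_u`, `t ∂_t + f ∂_f`, `x ∂_x - 2 f ∂_f - K ∂_K`, `u ∂_u`,
`f ∂_f + K ∂_K + D ∂_D`. -/
def generator : Fin 7 → Ext → Ext :=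
  ![fun _ ↦ ((1, 0, 0), (0, 0, 0)),
    fun _ ↦ ((0, 1, 0), (0, 0, 0)),
    fun _ ↦ ((0, 0, 1), (0, 0, 0)),
    fun z ↦ ((z.1.1, 0, 0), (z.2.1, 0, 0)),
    fun z ↦ ((0, z.1.2.1, 0), (-2 * z.2.1, 0, -z.2.2.2)),
    fun z ↦ ((0, 0, z.1.2.2), (0, 0, 0)),
    fun z ↦ ((0, 0, 0), (z.2.1, z.2.2.1, z.2.2.2))]

/-- The continuous equivalence transformations
`t̃ = t e^{ε₄} + ε₁`, `x̃ = x e^{ε₅} + ε₂`, `ũ = u e^{ε₆} + ε₃`,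
`f̃ = f e^{ε₄ - 2 ε₅ + ε₇}`, `D̃ = D e^{ε₇}`, `K̃ = K e^{-ε₅ + ε₇}`. -/
def continuousTransformation (ε₁ ε₂ ε₃ ε₄ ε₅ ε₆ ε₇ : ℝ) : Equiv.Perm Ext where
  toFun z :=
    ((z.1.1 * Real.exp ε₄ + ε₁, z.1.2.1 * Real.exp ε₅ + ε₂, z.1.2.2 * Real.exp ε₆ + ε₃),
      (z.2.1 * Real.exp (ε₄ - 2 * ε₅ + ε₇), z.2.2.1 * Real.exp ε₇,
        z.2.2.2 * Real.exp (-ε₅ + ε₇)))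
  invFun z :=
    (((z.1.1 - ε₁) / Real.exp ε₄, (z.1.2.1 - ε₂) / Real.exp ε₅, (z.1.2.2 - ε₃) / Real.exp ε₆),
      (z.2.1 / Real.exp (ε₄ - 2 * ε₅ + ε₇), z.2.2.1 / Real.exp ε₇,
        z.2.2.2 / Real.exp (-ε₅ + ε₇)))
  left_inv z := by simp
  right_inv z := by simp

/-- Change of sign of `t`, `D` and `K`. -/
def signTDK : Equiv.Perm Ext where
  toFun z := ((-z.1.1, z.1.2.1, z.1.2.2), (z.2.1, -z.2.2.1, -z.2.2.2))
  invFun z := ((-z.1.1, z.1.2.1, z.1.2.2), (z.2.1, -z.2.2.1, -z.2.2.2))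
  left_inv z := by simp
  right_inv z := by simp

/-- Change of sign of `x` and `K`. -/
def signXK : Equiv.Perm Ext where
  toFun z := ((z.1.1, -z.1.2.1, z.1.2.2), (z.2.1, z.2.2.1, -z.2.2.2))
  invFun z := ((z.1.1, -z.1.2.1, z.1.2.2), (z.2.1, z.2.2.1, -z.2.2.2))
  left_inv z := by simp
  right_inv z := by simp

/-- Change of sign of `u`. -/
def signU : Equiv.Perm Ext where
  toFun z := ((z.1.1, z.1.2.1, -z.1.2.2), z.2)
  invFun z := ((z.1.1, z.1.2.1, -z.1.2.2), z.2)
  left_inv z := by simp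
  right_inv z := by simp

/-- Change of sign of `f`, `D` and `K`. -/
def signFDK : Equiv.Perm Ext where
  toFun z := (z.1, (-z.2.1, -z.2.2.1, -z.2.2.2))
  invFun z := (z.1, (-z.2.1, -z.2.2.1, -z.2.2.2))
  left_inv z := by simp
  right_inv z := by simp

/-- The group generated by the continuous transformations and the four sign changes. -/
def generatedGroup : Subgroup (Equiv.Perm Ext) :=
  Subgroup.closure
    ({ψ | ∃ ε₁ ε₂ ε₃ ε₄ ε₅ ε₆ ε₇ : ℝ, ψ = continuousTransformation ε₁ ε₂ ε₃ ε₄ ε₅ ε₆ ε₇} ∪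
      {signTDK, signXK, signU, signFDK})

end DiffConv

end

/-!
An equivalence transformation maps the jets of solutions of one equation of the class to jets of
solutions of another. At a given point of `W` the derivatives `f_x`, `D_u`, `K_u` of the arbitrary
elements can be prescribed at will, and so can the free jet coordinates of a solution; comparing
coefficients in these parameters shows that each of `t̃`, `x̃`, `ũ` depends on its own variable
alone and that

* `f D̃ t̃_t = f̃ D x̃_x²` (leading terms),
* `D̃ (D x̃_xx + K x̃_x) = D K̃ x̃_x²` (terms linear in `u_x`),
* `D̃ ũ_uu + ũ_u D̃_u = 0`, `D D̃_D = D̃`, `D̃_K = 0` (terms quadratic in `u_x`).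

Since `f̃` is independent of `u`, `D`, `K`, and `D̃`, `K̃` of `t`, `x`, `f`, differentiating
these relations yields `t̃_tt = x̃_xx = ũ_uu = 0`. On the connected set `W` the
transformation is therefore a scaling with constant coefficients, and such scalings are the products
of the continuous transformations and the sign changes.

A flow of equivalences is a curve of scalings, so its velocity is, locally and then by connectedness
on all of `W`, a constant combination of the seven generators; conversely these generators integrate
to scalings.
-/

noncomputable section

namespace DiffConv

section SecondDerivatives

variable {E F H : Type*} [NormedAddCommGroup E] [NormedSpace ℝ E] [NormedAddCommGroup F]
  [NormedSpace ℝ F] [NormedAddCommGroup H] [NormedSpace ℝ H]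

theorem differentiableAt_fderiv {g : E → F} {p : E} (hg : ContDiffAt ℝ 2 g p) :
    DifferentiableAt ℝ (fderiv ℝ g) p :=
  (hg.fderiv_right (m := 1) (by norm_num)).differentiableAt (by simp)

theorem eventually_differentiableAt {g : E → F} {p : E} (hg : ContDiffAt ℝ 2 g p) :
    ∀ᶠ q in 𝓝 p, DifferentiableAt ℝ g q :=
  (hg.eventually (by simp)).mono fun _ hq ↦ hq.differentiableAt (by simp)

theorem hasFDerivAt_clm_fderiv_apply {g : E → F} {p : E} (hg : ContDiffAt ℝ 2 g p)
    (L : F →L[ℝ] H) (w : E) :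
    HasFDerivAt (fun q ↦ L (fderiv ℝ g q w)) (L ∘L (fderiv ℝ (fderiv ℝ g) p).flip w) p := by
  have h := (differentiableAt_fderiv hg).hasFDerivAt.clm_apply (hasFDerivAt_const w p)
  rw [ContinuousLinearMap.comp_zero, zero_add] at h
  exact L.hasFDerivAt.comp p h

theorem fderiv_fderiv_comm {g : E → F} {p : E} (hg : ContDiffAt ℝ 2 g p) (w w' : E) :
    fderiv ℝ (fderiv ℝ g) p w w' = fderiv ℝ (fderiv ℝ g) p w' w :=
  hg.isSymmSndFDerivAt (by simp) w w'

theorem fderiv_fderiv_comp {g : F → H} {γ : E → F} {p : E} (hg : ContDiffAt ℝ 2 g (γ p))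
    (hγ : ContDiffAt ℝ 2 γ p) (w w' : E) :
    fderiv ℝ (fderiv ℝ (g ∘ γ)) p w w' =
      fderiv ℝ (fderiv ℝ g) (γ p) (fderiv ℝ γ p w) (fderiv ℝ γ p w')
        + fderiv ℝ g (γ p) (fderiv ℝ (fderiv ℝ γ) p w w') := by
  have hγp : DifferentiableAt ℝ γ p := hγ.differentiableAt (by simp)
  have hfirst : fderiv ℝ (g ∘ γ) =ᶠ[𝓝 p] fun q ↦ fderiv ℝ g (γ q) ∘L fderiv ℝ γ q := by
    filter_upwards [hγp.continuousAt.eventually (eventually_differentiableAt hg),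
      eventually_differentiableAt hγ] with q hgq hγq
    exact fderiv_comp q hgq hγq
  have hsecond := ((differentiableAt_fderiv hg).hasFDerivAt.comp p hγp.hasFDerivAt).clm_comp
    (differentiableAt_fderiv hγ).hasFDerivAt
  rw [(hsecond.congr_of_eventuallyEq hfirst).fderiv]
  simp [add_comm]

end SecondDerivatives

section Jets

/-- The coordinate direction of `t`. -/
abbrev et : Base := (1, 0, 0)

/-- The coordinate direction of `x`. -/
abbrev ex : Base := (0, 1, 0)

/-- The coordinate direction of `u`. -/
abbrev eu : Base := (0, 0, 1)

theorem exists_implicit_solution {G : Base → ℝ} {p : Base} {n : WithTop ℕ∞} (hn : n ≠ 0)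
    (hG : ContDiffAt ℝ n G p) (hp : G p = 0) (hu : fderiv ℝ G p eu ≠ 0) :
    ∃ v : ℝ × ℝ → ℝ, v (p.1, p.2.1) = p.2.2 ∧ ContDiffAt ℝ n v (p.1, p.2.1) ∧
      ∀ᶠ s in 𝓝 (p.1, p.2.1), G (s.1, s.2, v s) = 0 := by
  let A : ((ℝ × ℝ) × ℝ) ≃L[ℝ] Base := ContinuousLinearEquiv.prodAssoc ℝ ℝ ℝ ℝ
  let q : (ℝ × ℝ) × ℝ := ((p.1, p.2.1), p.2.2)
  have hc : ContDiffAt ℝ n (G ∘ A) q := ContDiffAt.comp (g := G) q hG A.contDiff.contDiffAt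
  have hfd : fderiv ℝ (G ∘ A) q = fderiv ℝ G p ∘L (A : (ℝ × ℝ) × ℝ →L[ℝ] Base) :=
    ((hG.differentiableAt hn).hasFDerivAt.comp q A.hasFDerivAt).fderiv
  have hinv : (fderiv ℝ (G ∘ A) q ∘L .inr ℝ (ℝ × ℝ) ℝ).IsInvertible := by
    refine ⟨ContinuousLinearEquiv.unitsEquivAut ℝ (Units.mk0 _ hu), ?_⟩
    rw [hfd]
    ext
    simp [A]
  refine ⟨hc.implicitFunction hn hinv, hc.implicitFunction_apply_self hn hinv,
    hc.contDiffAt_implicitFunction hn hinv, ?_⟩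
  filter_upwards [hc.eventually_apply_implicitFunction hn hinv] with s hs
  exact hs.trans hp

/-- The graph of a function of `(t, x)`, as a parametrized surface. -/
def graph (v : ℝ × ℝ → ℝ) (s : ℝ × ℝ) : Base := (s.1, s.2, v s)

theorem contDiffAt_graph {v : ℝ × ℝ → ℝ} {s : ℝ × ℝ} {n : WithTop ℕ∞} (hv : ContDiffAt ℝ n v s) :
    ContDiffAt ℝ n (graph v) s :=
  contDiffAt_fst.prodMk (contDiffAt_snd.prodMk hv)

theorem fderiv_graph {v : ℝ × ℝ → ℝ} {s : ℝ × ℝ} (hv : DifferentiableAt ℝ v s) (w : ℝ × ℝ) :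
    fderiv ℝ (graph v) s w = (w.1, w.2, fderiv ℝ v s w) := by
  have h : HasFDerivAt (graph v) _ s :=
    hasFDerivAt_fst.prodMk (hasFDerivAt_snd.prodMk hv.hasFDerivAt)
  simp [h.fderiv]

theorem fderiv_fderiv_graph {v : ℝ × ℝ → ℝ} {s : ℝ × ℝ} (hv : ContDiffAt ℝ 2 v s) (w w' : ℝ × ℝ) :
    fderiv ℝ (fderiv ℝ (graph v)) s w w' = (0, 0, fderiv ℝ (fderiv ℝ v) s w w') := by
  have hfirst : (fun q ↦ fderiv ℝ (graph v) q w') =ᶠ[𝓝 s]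
      fun q ↦ (w'.1, w'.2, fderiv ℝ v q w') :=
    (eventually_differentiableAt hv).mono fun q hq ↦ fderiv_graph hq w'
  have hsecond : HasFDerivAt (fun q ↦ (w'.1, w'.2, fderiv ℝ v q w')) _ s :=
    (hasFDerivAt_const w'.1 s).prodMk ((hasFDerivAt_const w'.2 s).prodMk
      (hasFDerivAt_clm_fderiv_apply hv (.id ℝ ℝ) w'))
  have := (hasFDerivAt_clm_fderiv_apply (contDiffAt_graph hv) (.id ℝ Base) w').unique
    (hsecond.congr_of_eventuallyEq hfirst)
  simpa using DFunLike.congr_fun this w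

section Implicit

variable {G : Base → ℝ} {v : ℝ × ℝ → ℝ} {s : ℝ × ℝ}

theorem fderiv_apply_of_implicit (hG : DifferentiableAt ℝ G (graph v s))
    (hv : DifferentiableAt ℝ v s) (h : ∀ᶠ q in 𝓝 s, G (graph v q) = 0) (w : ℝ × ℝ) :
    fderiv ℝ G (graph v s) (w.1, w.2, fderiv ℝ v s w) = 0 := by
  have hgraph : DifferentiableAt ℝ (graph v) s :=
    differentiableAt_fst.prodMk (differentiableAt_snd.prodMk hv)
  have hzero : fderiv ℝ (G ∘ graph v) s w = 0 := by
    simp [Filter.EventuallyEq.fderiv_eq (show G ∘ graph v =ᶠ[𝓝 s] 0 from h)]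
  rwa [fderiv_comp s hG hgraph, ContinuousLinearMap.comp_apply, fderiv_graph hv] at hzero

theorem fderiv_fderiv_of_implicit (hG : ContDiffAt ℝ 2 G (graph v s)) (hv : ContDiffAt ℝ 2 v s)
    (h : ∀ᶠ q in 𝓝 s, G (graph v q) = 0) (w : ℝ × ℝ) :
    fderiv ℝ (fderiv ℝ G) (graph v s) (w.1, w.2, fderiv ℝ v s w) (w.1, w.2, fderiv ℝ v s w)
      + fderiv ℝ (fderiv ℝ v) s w w * fderiv ℝ G (graph v s) eu = 0 := by
  have hzero : fderiv ℝ (fderiv ℝ (G ∘ graph v)) s w w = 0 := by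
    have hfirst : fderiv ℝ (G ∘ graph v) =ᶠ[𝓝 s] 0 := by
      simpa using (show G ∘ graph v =ᶠ[𝓝 s] fun _ ↦ 0 from h).fderiv
    simp [hfirst.fderiv_eq]
  rw [fderiv_fderiv_comp hG (contDiffAt_graph hv), fderiv_graph (hv.differentiableAt (by simp)),
    fderiv_fderiv_graph hv] at hzero
  rw [← smul_eq_mul, ← map_smul, ← hzero]
  simp

end Implicit

namespace Equation

variable {θ : Equation}

theorem holdsAt_iff {v : ℝ × ℝ → ℝ} {s : ℝ × ℝ} (hs : v s ∈ θ.J) (hv : ContDiffAt ℝ 2 v s) :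
    θ.HoldsAt v s ↔
      θ.f s.2 * fderiv ℝ v s (1, 0) =
        θ.D (v s) * fderiv ℝ (fderiv ℝ v) s (0, 1) (0, 1)
          + deriv θ.D (v s) * fderiv ℝ v s (0, 1) ^ 2 + θ.K (v s) * fderiv ℝ v s (0, 1) := by
  obtain ⟨t, x⟩ := s
  have hline (y : ℝ) : HasDerivAt (fun y : ℝ ↦ (t, y)) (0, 1) y :=
    (hasDerivAt_const y t).prodMk (hasDerivAt_id y)
  have hvd : DifferentiableAt ℝ v (t, x) := hv.differentiableAt (by simp)
  have hvt : HasDerivAt (fun t ↦ v (t, x)) (fderiv ℝ v (t, x) (1, 0)) t :=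
    hvd.hasFDerivAt.comp_hasDerivAt t ((hasDerivAt_id t).prodMk (hasDerivAt_const t x))
  have hvx : ∀ᶠ y in 𝓝 x, HasDerivAt (fun y ↦ v (t, y)) (fderiv ℝ v (t, y) (0, 1)) y := by
    filter_upwards [(hline x).continuousAt.eventually (eventually_differentiableAt hv)] with y hy
    exact hy.hasFDerivAt.comp_hasDerivAt y (hline y)
  have hvxx : HasDerivAt (fun y ↦ fderiv ℝ v (t, y) (0, 1))
      (fderiv ℝ (fderiv ℝ v) (t, x) (0, 1) (0, 1)) x :=
    (hasFDerivAt_clm_fderiv_apply hv (.id ℝ ℝ) (0, 1)).comp_hasDerivAt x (hline x)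
  have hD : HasDerivAt θ.D (deriv θ.D (v (t, x))) (v (t, x)) :=
    ((θ.smooth_D.contDiffAt (θ.isOpen_J.mem_nhds hs)).differentiableAt (by simp)).hasDerivAt
  have hflux : (fun y ↦ θ.D (v (t, y)) * deriv (fun y ↦ v (t, y)) y) =ᶠ[𝓝 x]
      fun y ↦ θ.D (v (t, y)) * fderiv ℝ v (t, y) (0, 1) :=
    hvx.mono fun y hy ↦ congrArg (θ.D (v (t, y)) * ·) hy.deriv
  have hdiff := ((hD.comp x hvx.self_of_nhds).mul hvxx).congr_of_eventuallyEq hflux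
  rw [HoldsAt, hvt.deriv, hdiff.deriv, hvx.self_of_nhds.deriv]
  simp only [Function.comp_apply]
  ring_nf

theorem holdsAt_iff_of_implicit {G : Base → ℝ} {v : ℝ × ℝ → ℝ} {s : ℝ × ℝ} {b : ℝ}
    (hs : v s ∈ θ.J) (hG : ContDiffAt ℝ 2 G (graph v s)) (hv : ContDiffAt ℝ 2 v s)
    (h : ∀ᶠ q in 𝓝 s, G (graph v q) = 0) (hu : fderiv ℝ G (graph v s) eu ≠ 0)
    (hb : fderiv ℝ G (graph v s) (0, 1, b) = 0) :
    θ.HoldsAt v s ↔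
      θ.f s.2 * fderiv ℝ G (graph v s) et =
        θ.D (v s) * fderiv ℝ (fderiv ℝ G) (graph v s) (0, 1, b) (0, 1, b)
          - (deriv θ.D (v s) * b ^ 2 + θ.K (v s) * b) * fderiv ℝ G (graph v s) eu := by
  have hGs : DifferentiableAt ℝ G (graph v s) := hG.differentiableAt (by simp)
  have hvs : DifferentiableAt ℝ v s := hv.differentiableAt (by simp)
  have split (r r' c : ℝ) : fderiv ℝ G (graph v s) (r, r', c) =
      fderiv ℝ G (graph v s) (r, r', 0) + c * fderiv ℝ G (graph v s) eu := by
    rw [← smul_eq_mul, ← map_smul, ← map_add]; simp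
  have hvt := fderiv_apply_of_implicit hGs hvs h (1, 0)
  have hvx : fderiv ℝ v s (0, 1) = b := by
    have := fderiv_apply_of_implicit hGs hvs h (0, 1)
    rw [split] at this hb
    exact mul_right_cancel₀ hu (by linarith)
  have hvxx := fderiv_fderiv_of_implicit hG hv h (0, 1)
  rw [split] at hvt
  rw [hvx] at hvxx
  rw [holdsAt_iff hs hv, hvx, ← mul_left_inj' hu]
  constructor <;> intro heq
  · linear_combination (-1) * heq + θ.f s.2 * hvt - θ.D (v s) * hvxx
  · linear_combination (-1) * heq + θ.f s.2 * hvt - θ.D (v s) * hvxx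

end Equation

end Jets

section JetTransformation

/-- The function of `(t, x)` with value `y.2.2`, slopes `α`, `β`, second derivatives `δ` (in `t`)
and `γ` (in `x`), and vanishing mixed derivative at `(y.1, y.2.1)`. -/
def quadratic (y : Base) (α β γ δ : ℝ) (s : ℝ × ℝ) : ℝ :=
  y.2.2 + α * (s.1 - y.1) + β * (s.2 - y.2.1) + γ / 2 * (s.2 - y.2.1) ^ 2
    + δ / 2 * (s.1 - y.1) ^ 2

/-- The covector on the space of `(t, x, u)` that vanishes on the tangent plane of a graph with
slopes `α` in `t` and `β` in `x`. -/
def conormal (α β : ℝ) : Base →L[ℝ] ℝ :=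
  α • .fst ℝ ℝ (ℝ × ℝ)
    + (β • .fst ℝ ℝ ℝ - .snd ℝ ℝ ℝ) ∘L .snd ℝ ℝ (ℝ × ℝ)

theorem conormal_apply (α β : ℝ) (w : Base) :
    conormal α β w = α * w.1 + β * w.2.1 - w.2.2 := by
  simp [conormal]; ring

/-- The defining function `v - u` of the graph of `v = quadratic y α β γ δ`. -/
def quadraticDefect (y : Base) (α β γ δ : ℝ) (q : Base) : ℝ :=
  quadratic y α β γ δ (q.1, q.2.1) - q.2.2

variable (y : Base) (α β γ δ : ℝ)

theorem contDiff_quadratic {n : WithTop ℕ∞} : ContDiff ℝ n (quadratic y α β γ δ) := by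
  unfold quadratic; fun_prop

theorem contDiff_quadraticDefect {n : WithTop ℕ∞} :
    ContDiff ℝ n (quadraticDefect y α β γ δ) := by
  unfold quadraticDefect quadratic; fun_prop

theorem fderiv_quadraticDefect (q : Base) :
    fderiv ℝ (quadraticDefect y α β γ δ) q =
      conormal (α + δ * (q.1 - y.1)) (β + γ * (q.2.1 - y.2.1)) := by
  have ht : HasFDerivAt (fun q ↦ q.1 - y.1) (.fst ℝ ℝ (ℝ × ℝ)) q :=
    hasFDerivAt_fst.sub_const y.1
  have hx : HasFDerivAt (fun q : Base ↦ q.2.1 - y.2.1) (.fst ℝ ℝ ℝ ∘L .snd ℝ ℝ (ℝ × ℝ)) q :=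
    hasFDerivAt_snd.fst.sub_const y.2.1
  have h : HasFDerivAt (quadraticDefect y α β γ δ) _ q :=
    (((((ht.const_mul α).const_add y.2.2).add (hx.const_mul β)).add
      ((hx.pow 2).const_mul (γ / 2))).add ((ht.pow 2).const_mul (δ / 2))).sub hasFDerivAt_snd.snd
  rw [h.fderiv]
  ext <;> simp [conormal_apply] <;> ring

theorem fderiv_fderiv_quadraticDefect (q w w' : Base) :
    fderiv ℝ (fderiv ℝ (quadraticDefect y α β γ δ)) q w w' =
      δ * w.1 * w'.1 + γ * w.2.1 * w'.2.1 := by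
  have ht : HasFDerivAt (fun q ↦ q.1 - y.1) (.fst ℝ ℝ (ℝ × ℝ)) q :=
    hasFDerivAt_fst.sub_const y.1
  have hx : HasFDerivAt (fun q : Base ↦ q.2.1 - y.2.1) (.fst ℝ ℝ ℝ ∘L .snd ℝ ℝ (ℝ × ℝ)) q :=
    hasFDerivAt_snd.fst.sub_const y.2.1
  have h := ((((ht.const_mul δ).const_add α).mul_const w'.1).add
    (((hx.const_mul γ).const_add β).mul_const w'.2.1)).sub_const w'.2.2
  have hfirst : (fun q ↦ fderiv ℝ (quadraticDefect y α β γ δ) q w') =ᶠ[𝓝 q] _ :=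
    .of_eq (funext fun q ↦ by rw [fderiv_quadraticDefect, conormal_apply])
  have hsecond := (hasFDerivAt_clm_fderiv_apply
    (contDiff_quadraticDefect y α β γ δ).contDiffAt (.id ℝ ℝ) w').unique
    (h.congr_of_eventuallyEq hfirst)
  calc _ = _ := DFunLike.congr_fun hsecond w
    _ = δ * w.1 * w'.1 + γ * w.2.1 * w'.2.1 := by simp; ring

/-- The values of `f`, `D`, `D_u` and `K` at a point: all that the equation involves there. -/
structure CoefficientJet where
  f : ℝ
  D : ℝ
  derivD : ℝ
  K : ℝ
  f_ne_zero : f ≠ 0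
  D_ne_zero : D ≠ 0

/-- The coefficients of an equation at a point of its domain. -/
def Equation.jet (θ : Equation) (p : Base) (hp : p ∈ θ.dom) : CoefficientJet :=
  ⟨θ.f p.2.1, θ.D p.2.2, deriv θ.D p.2.2, θ.K p.2.2, θ.f_ne_zero _ hp.1, θ.D_ne_zero _ hp.2⟩

/-- A point transformation with derivative `A` and second derivative `B` at a point identifies the
equation with coefficients `k` at that point and the equation with coefficients `k'` at its image.
The jet of the transformed function is `(α, β, γ, δ) = (v_t, v_x, v_xx, v_tt)`, and `b` is the
`x`-derivative of the original function. -/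
structure MapsJets (A : Base →L[ℝ] Base) (B : Base →L[ℝ] Base →L[ℝ] Base)
    (k k' : CoefficientJet) : Prop where
  bijective : Function.Bijective A
  iff_of_jet : ∀ α β γ δ b : ℝ, conormal α β (A eu) ≠ 0 → conormal α β (A (0, 1, b)) = 0 →
    (k.f * conormal α β (A et) =
        k.D * (conormal α β (B (0, 1, b) (0, 1, b))
          + δ * (A (0, 1, b)).1 ^ 2 + γ * (A (0, 1, b)).2.1 ^ 2)
          - (k.derivD * b ^ 2 + k.K * b) * conormal α β (A eu) ↔
      k'.f * α = k'.D * γ + k'.derivD * β ^ 2 + k'.K * β)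

variable {θ : Equation} {α β γ δ}

theorem Equation.holdsAt_quadratic {y : Base} (hy : y ∈ θ.dom) :
    θ.HoldsAt (quadratic y α β γ δ) (y.1, y.2.1) ↔
      θ.f y.2.1 * α = θ.D y.2.2 * γ + deriv θ.D y.2.2 * β ^ 2 + θ.K y.2.2 * β := by
  have hval : quadratic y α β γ δ (y.1, y.2.1) = y.2.2 := by simp [quadratic]
  have hgraph : graph (quadratic y α β γ δ) (y.1, y.2.1) = y := by simp [graph, hval]
  have h := θ.holdsAt_iff_of_implicit (G := quadraticDefect y α β γ δ) (b := β)
    (hval ▸ hy.2) (contDiff_quadraticDefect ..).contDiffAt (contDiff_quadratic ..).contDiffAt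
    (.of_forall fun q ↦ by simp [quadraticDefect, graph])
  rw [hgraph, hval] at h
  simp only [fderiv_quadraticDefect, fderiv_fderiv_quadraticDefect, conormal_apply] at h
  rw [h (by simp) (by simp)]
  simp only [sub_self, mul_zero, add_zero, mul_one, zero_add, sub_zero, zero_sub, mul_neg,
    sub_neg_eq_add, add_assoc]

theorem MapsEquationAt.mapsJets {φ : Ext → Ext} {θ' : Equation} {p : Base}
    (h : MapsEquationAt φ θ θ' p) (hp : p ∈ θ.dom) (hΨ : ContDiffAt ℝ ∞ (induced φ θ) p) :
    MapsJets (fderiv ℝ (induced φ θ) p) (fderiv ℝ (fderiv ℝ (induced φ θ)) p)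
      (θ.jet p hp) (θ'.jet (induced φ θ p) h.mem_dom) where
  bijective := h.nonsingular
  iff_of_jet α β γ δ b hu hb := by
    set Ψ := induced φ θ
    set ℓ := quadraticDefect (Ψ p) α β γ δ
    have hℓ {n : WithTop ℕ∞} (q : Base) : ContDiffAt ℝ n ℓ q :=
      (contDiff_quadraticDefect ..).contDiffAt
    have hΨ₂ : ContDiffAt ℝ 2 Ψ p := hΨ.of_le ENat.LEInfty.out
    have hG₁ (w : Base) : fderiv ℝ (ℓ ∘ Ψ) p w = conormal α β (fderiv ℝ Ψ p w) := by
      rw [fderiv_comp p ((hℓ _).differentiableAt one_ne_zero) (hΨ.differentiableAt (by simp)),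
        fderiv_quadraticDefect]
      simp
    have hG₂ (w : Base) : fderiv ℝ (fderiv ℝ (ℓ ∘ Ψ)) p w w =
        conormal α β (fderiv ℝ (fderiv ℝ Ψ) p w w) + δ * (fderiv ℝ Ψ p w).1 ^ 2
          + γ * (fderiv ℝ Ψ p w).2.1 ^ 2 := by
      rw [fderiv_fderiv_comp (hℓ _) hΨ₂, fderiv_fderiv_quadraticDefect, fderiv_quadraticDefect]
      simp only [sub_self, mul_zero, add_zero]
      ring
    have hG : ContDiffAt ℝ ∞ (ℓ ∘ Ψ) p := (hℓ _).comp p hΨ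
    obtain ⟨v, hvp, hv, hvG⟩ := exists_implicit_solution (by simp) hG
      (by simp [ℓ, quadraticDefect, quadratic]) (by rwa [hG₁])
    have hgraph : graph v (p.1, p.2.1) = p := by simp [graph, hvp]
    have hsource := θ.holdsAt_iff_of_implicit (G := ℓ ∘ Ψ) (b := b) (hvp ▸ hp.2)
      (hgraph.symm ▸ hG.of_le ENat.LEInfty.out) (hv.of_le ENat.LEInfty.out) hvG
    rw [hgraph, hvp, hG₁, hG₁, hG₁, hG₂] at hsource
    have htarget := h.holds_iff v (quadratic (Ψ p) α β γ δ) hvp hv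
      (contDiff_quadratic ..).contDiffAt (hvG.mono fun s hs ↦ sub_eq_zero.mp hs)
    exact (hsource hu hb).symm.trans (htarget.trans (θ'.holdsAt_quadratic h.mem_dom))

end JetTransformation

namespace MapsJets

variable {A : Base →L[ℝ] Base} {B : Base →L[ℝ] Base →L[ℝ] Base} {k k' : CoefficientJet}

theorem apply_slope (A : Base →L[ℝ] Base) (b : ℝ) : A (0, 1, b) = A ex + b • A eu := by
  rw [← map_smul, ← map_add]; simp

theorem not_proportional (h : MapsJets A B k k') {b r : ℝ} (hr : r ≠ 0) (s : ℝ) :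
    r • A eu ≠ s • A (0, 1, b) := by
  intro heq
  rw [← map_smul, ← map_smul] at heq
  have := h.bijective.1 heq
  simp only [Prod.smul_mk, smul_eq_mul, mul_zero, mul_one, Prod.mk.injEq, true_and] at this
  obtain ⟨rfl, hrs⟩ := this
  exact hr (by linarith)

-- The free second `t`-derivative `δ` enters the transformed equation with the coefficient
-- `(A (0, 1, b)).1 ^ 2`.
theorem time_slope_eq_zero (h : MapsJets A B k k') (b : ℝ) : (A (0, 1, b)).1 = 0 := by
  by_contra hT
  set w := A (0, 1, b) with hw
  obtain ⟨α, β, hu, hb⟩ : ∃ α β, conormal α β (A eu) ≠ 0 ∧ conormal α β w = 0 := by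
    by_contra! hcon
    have key (β : ℝ) : conormal ((w.2.2 - β * w.2.1) / w.1) β (A eu) = 0 := by
      by_contra hne
      refine hcon _ β hne ?_
      rw [conormal_apply]; field_simp; ring
    have h₀ := key 0
    have h₁ := key 1
    simp only [conormal_apply] at h₀ h₁
    field_simp at h₀ h₁
    refine h.not_proportional (b := b) hT (A eu).1 (Prod.ext ?_ (Prod.ext ?_ ?_)) <;>
      simp only [Prod.smul_fst, Prod.smul_snd, smul_eq_mul, ← hw] <;> linarith
  obtain ⟨γ, hγ⟩ : ∃ γ, k'.f * α = k'.D * γ + k'.derivD * β ^ 2 + k'.K * β :=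
    ⟨(k'.f * α - k'.derivD * β ^ 2 - k'.K * β) / k'.D, by field_simp [k'.D_ne_zero]; ring⟩
  have h₀ := (h.iff_of_jet α β γ 0 b hu hb).2 hγ
  have h₁ := (h.iff_of_jet α β γ 1 b hu hb).2 hγ
  have hD : k.D * w.1 ^ 2 = 0 := by linarith
  exact mul_ne_zero k.D_ne_zero (pow_ne_zero 2 hT) hD

theorem time_u_eq_zero (h : MapsJets A B k k') : (A eu).1 = 0 := by
  have h₀ := h.time_slope_eq_zero 0
  have h₁ := h.time_slope_eq_zero 1
  rw [apply_slope] at h₀ h₁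
  simp only [Prod.fst_add, Prod.smul_fst, smul_eq_mul] at h₀ h₁
  linarith

theorem time_x_eq_zero (h : MapsJets A B k k') : (A ex).1 = 0 := h.time_slope_eq_zero 0

theorem time_t_ne_zero (h : MapsJets A B k k') : (A et).1 ≠ 0 := by
  intro ht
  obtain ⟨w, hw⟩ := h.bijective.2 et
  have hsplit : A w = w.1 • A et + w.2.1 • A ex + w.2.2 • A eu := by
    simp_rw [← map_smul, ← map_add]; simp
  simpa [hw, ht, h.time_x_eq_zero, h.time_u_eq_zero] using congrArg Prod.fst hsplit

-- With `β` fixed by the slope, `α` stays free; comparing `α = 0` and `α = 1` isolates the leading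
-- coefficients.
theorem leading_of_slope (h : MapsJets A B k k') {b : ℝ} (hB : (B (0, 1, b) (0, 1, b)).1 = 0)
    (hX : (A (0, 1, b)).2.1 ≠ 0) :
    k.f * k'.D * (A et).1 = k'.f * k.D * (A (0, 1, b)).2.1 ^ 2 := by
  set w := A (0, 1, b) with hw
  obtain ⟨β, hβ⟩ : ∃ β, β * w.2.1 = w.2.2 := ⟨w.2.2 / w.2.1, by field_simp⟩
  have hb (α : ℝ) : conormal α β w = 0 := by
    rw [conormal_apply, hβ, h.time_slope_eq_zero]; ring
  have hu (α : ℝ) : conormal α β (A eu) ≠ 0 := by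
    intro h₀
    rw [conormal_apply, h.time_u_eq_zero] at h₀
    refine h.not_proportional (b := b) hX (A eu).2.1 (Prod.ext ?_ (Prod.ext ?_ ?_)) <;>
      simp only [Prod.smul_fst, Prod.smul_snd, smul_eq_mul, ← hw]
    · rw [h.time_u_eq_zero, h.time_slope_eq_zero]; ring
    · ring
    · linear_combination (-w.2.1) * h₀ + (A eu).2.1 * hβ
  have relation (α : ℝ) := (h.iff_of_jet α β ((k'.f * α - k'.derivD * β ^ 2 - k'.K * β) / k'.D) 0 b
    (hu α) (hb α)).2 (by field_simp [k'.D_ne_zero]; ring)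
  have h₀ := relation 0
  have h₁ := relation 1
  simp only [conormal_apply, h.time_u_eq_zero, hB] at h₀ h₁
  have hD := k'.D_ne_zero
  field_simp at h₀ h₁
  linear_combination h₁ - h₀

theorem space_u_eq_zero (h : MapsJets A B k k')
    (hB : ∀ b : ℝ, (B (0, 1, b) (0, 1, b)).1 = 0) : (A eu).2.1 = 0 := by
  by_contra hX
  have hslope (c : ℝ) : (A (0, 1, (c - (A ex).2.1) / (A eu).2.1)).2.1 = c := by
    rw [apply_slope]
    simp only [Prod.snd_add, Prod.fst_add, Prod.smul_snd, Prod.smul_fst, smul_eq_mul]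
    field_simp; ring
  have h₁ := h.leading_of_slope (hB _) (b := (1 - (A ex).2.1) / (A eu).2.1) (by simp [hslope])
  have h₂ := h.leading_of_slope (hB _) (b := (2 - (A ex).2.1) / (A eu).2.1) (by simp [hslope])
  rw [hslope] at h₁ h₂
  exact mul_ne_zero k'.f_ne_zero k.D_ne_zero (by linarith)

theorem state_u_ne_zero (h : MapsJets A B k k')
    (hB : ∀ b : ℝ, (B (0, 1, b) (0, 1, b)).1 = 0) : (A eu).2.2 ≠ 0 := by
  intro hU
  refine h.not_proportional (b := 0) one_ne_zero 0 (Prod.ext ?_ (Prod.ext ?_ ?_)) <;>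
    simp [h.time_u_eq_zero, h.space_u_eq_zero hB, hU]

theorem space_x_ne_zero (h : MapsJets A B k k')
    (hB : ∀ b : ℝ, (B (0, 1, b) (0, 1, b)).1 = 0) : (A ex).2.1 ≠ 0 := by
  intro hX
  have hsmul : A ((A eu).2.2 • ex) = A ((A ex).2.2 • eu) := by
    rw [map_smul, map_smul]
    refine Prod.ext ?_ (Prod.ext ?_ ?_) <;>
      simp [h.time_x_eq_zero, h.time_u_eq_zero, h.space_u_eq_zero hB, hX, mul_comm]
  have := congrArg (fun w : Base ↦ w.2.1) (h.bijective.1 hsmul)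
  exact h.state_u_ne_zero hB (by simpa using this)

theorem leading (h : MapsJets A B k k')
    (hB : ∀ b : ℝ, (B (0, 1, b) (0, 1, b)).1 = 0) :
    k.f * k'.D * (A et).1 = k'.f * k.D * (A ex).2.1 ^ 2 :=
  h.leading_of_slope (hB 0) (h.space_x_ne_zero hB)

section Diagonal

variable {T X U X₂ U₂ : ℝ}

theorem slope_relation (h : MapsJets A B k k')
    (hA : ∀ w, A w = (T * w.1, X * w.2.1, U * w.2.2))
    (hB : ∀ b : ℝ, B (0, 1, b) (0, 1, b) = (0, X₂, b ^ 2 * U₂)) (b : ℝ) :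
    k.D * (k'.D * (b * X₂ - b ^ 2 * (U₂ * X / U)) - (k'.derivD * b ^ 2 * U * X + k'.K * b * X ^ 2))
      + k'.D * (k.derivD * b ^ 2 + k.K * b) * X = 0 := by
  have hX : X ≠ 0 := by simpa [hA] using h.space_x_ne_zero (by simp [hB])
  have hU : U ≠ 0 := by simpa [hA] using h.state_u_ne_zero (by simp [hB])
  have hD := k'.D_ne_zero
  have key := (h.iff_of_jet 0 (b * U / X)
    (-(k'.derivD * (b * U / X) ^ 2 + k'.K * (b * U / X)) / k'.D) 0 b
    (by simpa [hA, conormal_apply] using hU)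
    (by simp only [hA, conormal_apply]; field_simp; ring)).2 (by field_simp; ring)
  simp only [hA, conormal_apply, hB] at key
  field_simp at key ⊢
  linear_combination (-1) * key

theorem diffusion (h : MapsJets A B k k')
    (hA : ∀ w, A w = (T * w.1, X * w.2.1, U * w.2.2))
    (hB : ∀ b : ℝ, B (0, 1, b) (0, 1, b) = (0, X₂, b ^ 2 * U₂)) :
    k.derivD * k'.D * U = k.D * (k'.D * U₂ + k'.derivD * U ^ 2) := by
  have hX : X ≠ 0 := by simpa [hA] using h.space_x_ne_zero (by simp [hB])
  have hU : U ≠ 0 := by simpa [hA] using h.state_u_ne_zero (by simp [hB])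
  have h₁ := h.slope_relation hA hB 1
  have h₂ := h.slope_relation hA hB (-1)
  field_simp at h₁ h₂
  refine mul_left_cancel₀ hX ?_
  linear_combination (h₁ + h₂) / 2

theorem convection (h : MapsJets A B k k')
    (hA : ∀ w, A w = (T * w.1, X * w.2.1, U * w.2.2))
    (hB : ∀ b : ℝ, B (0, 1, b) (0, 1, b) = (0, X₂, b ^ 2 * U₂)) :
    k'.D * (k.D * X₂ + k.K * X) = k.D * k'.K * X ^ 2 := by
  have h₁ := h.slope_relation hA hB 1
  have h₂ := h.slope_relation hA hB (-1)
  linear_combination (h₁ - h₂) / 2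

end Diagonal

end MapsJets

section TestEquations

namespace Equation

variable {θ : Equation} {p : Base}

theorem isOpen_dom (θ : Equation) : IsOpen θ.dom :=
  (θ.isOpen_I.preimage (by fun_prop)).inter (θ.isOpen_J.preimage (by fun_prop))

theorem contDiffAt_f {x : ℝ} (hx : x ∈ θ.I) : ContDiffAt ℝ ∞ θ.f x :=
  θ.smooth_f.contDiffAt (θ.isOpen_I.mem_nhds hx)

theorem contDiffAt_D {u : ℝ} (hu : u ∈ θ.J) : ContDiffAt ℝ ∞ θ.D u :=
  θ.smooth_D.contDiffAt (θ.isOpen_J.mem_nhds hu)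

theorem contDiffAt_K {u : ℝ} (hu : u ∈ θ.J) : ContDiffAt ℝ ∞ θ.K u :=
  θ.smooth_K.contDiffAt (θ.isOpen_J.mem_nhds hu)

theorem contDiffAt_lift (hp : p ∈ θ.dom) : ContDiffAt ℝ ∞ θ.lift p := by
  have hx : ContDiffAt ℝ ∞ (fun q : Base ↦ q.2.1) p := by fun_prop
  have hu : ContDiffAt ℝ ∞ (fun q : Base ↦ q.2.2) p := by fun_prop
  exact contDiffAt_id.prodMk (((contDiffAt_f hp.1).comp p hx).prodMk
    (((contDiffAt_D hp.2).comp p hu).prodMk ((contDiffAt_K hp.2).comp p hu)))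

end Equation

/-- The derivative of the graph `Equation.lift` of arbitrary elements with derivatives `f₁`, `D₁`,
`K₁`. -/
def liftDeriv (f₁ D₁ K₁ : ℝ) : Base →L[ℝ] Ext :=
  .prod (.id ℝ Base) <| .prod (f₁ • (.fst ℝ ℝ ℝ ∘L .snd ℝ ℝ (ℝ × ℝ))) <|
    .prod (D₁ • (.snd ℝ ℝ ℝ ∘L .snd ℝ ℝ (ℝ × ℝ))) (K₁ • (.snd ℝ ℝ ℝ ∘L .snd ℝ ℝ (ℝ × ℝ)))

theorem liftDeriv_apply (f₁ D₁ K₁ : ℝ) (w : Base) :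
    liftDeriv f₁ D₁ K₁ w = (w, (f₁ * w.2.1, D₁ * w.2.2, K₁ * w.2.2)) := rfl

namespace Equation

variable {θ : Equation} {p : Base}

theorem hasFDerivAt_lift (hp : p ∈ θ.dom) :
    HasFDerivAt θ.lift (liftDeriv (deriv θ.f p.2.1) (deriv θ.D p.2.2) (deriv θ.K p.2.2)) p := by
  have hx : HasFDerivAt (fun q : Base ↦ q.2.1) (.fst ℝ ℝ ℝ ∘L .snd ℝ ℝ (ℝ × ℝ)) p :=
    hasFDerivAt_snd.fst
  have hu : HasFDerivAt (fun q : Base ↦ q.2.2) (.snd ℝ ℝ ℝ ∘L .snd ℝ ℝ (ℝ × ℝ)) p :=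
    hasFDerivAt_snd.snd
  exact (hasFDerivAt_id p).prodMk
    ((((contDiffAt_f hp.1).differentiableAt (by simp)).hasDerivAt.comp_hasFDerivAt p hx).prodMk
    ((((contDiffAt_D hp.2).differentiableAt (by simp)).hasDerivAt.comp_hasFDerivAt p hu).prodMk
    (((contDiffAt_K hp.2).differentiableAt (by simp)).hasDerivAt.comp_hasFDerivAt p hu)))

theorem fst_fderiv_fderiv_lift (hp : p ∈ θ.dom) (w w' : Base) :
    (fderiv ℝ (fderiv ℝ θ.lift) p w w').1 = 0 := by
  have hconst : (fun q ↦ (fderiv ℝ θ.lift q w').1) =ᶠ[𝓝 p] fun _ ↦ w' :=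
    Filter.eventually_of_mem (θ.isOpen_dom.mem_nhds hp) fun q hq ↦ by
      simp [(hasFDerivAt_lift hq).fderiv, liftDeriv_apply]
  have h := (hasFDerivAt_clm_fderiv_apply ((contDiffAt_lift hp).of_le ENat.LEInfty.out)
    (.fst ℝ Base (ℝ × ℝ × ℝ)) w').unique ((hasFDerivAt_const w' p).congr_of_eventuallyEq hconst)
  exact DFunLike.congr_fun h w

end Equation

theorem hasDerivAt_mul_exp {f₀ f₁ x₀ x : ℝ} (hf₀ : f₀ ≠ 0) :
    HasDerivAt (fun x ↦ f₀ * Real.exp (f₁ / f₀ * (x - x₀)))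
      (f₁ * Real.exp (f₁ / f₀ * (x - x₀))) x := by
  have h := ((((hasDerivAt_id x).sub_const x₀).const_mul (f₁ / f₀)).exp).const_mul f₀
  refine h.congr_deriv ?_
  simp only [id_eq]
  field_simp

theorem hasDerivAt_quadratic_poly (K₀ K₁ u₀ u : ℝ) :
    HasDerivAt (fun u ↦ K₀ + K₁ * (u - u₀) + (u - u₀) ^ 2) (K₁ + 2 * (u - u₀)) u := by
  have h := (hasDerivAt_id u).sub_const u₀
  refine (((h.const_mul K₁).const_add K₀).add (h.pow 2)).congr_deriv ?_
  simp

-- `K_u` takes different values at `u₀` and `u₀ + 1`, so the equation is nonlinear whatever `K₁` is.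
theorem exists_equation {z : Ext} (hz : z ∈ regular) (f₁ D₁ K₁ : ℝ) :
    ∃ (θ : Equation) (p : Base), p ∈ θ.dom ∧ θ.lift p = z ∧
      deriv θ.f p.2.1 = f₁ ∧ deriv θ.D p.2.2 = D₁ ∧ deriv θ.K p.2.2 = K₁ := by
  obtain ⟨⟨t₀, x₀, u₀⟩, f₀, D₀, K₀⟩ := z
  obtain ⟨hf₀ : f₀ ≠ 0, hD₀ : D₀ ≠ 0⟩ := hz
  have hK := hasDerivAt_quadratic_poly K₀ K₁ u₀
  refine ⟨{ I := Set.univ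
            J := Set.univ
            f := fun x ↦ f₀ * Real.exp (f₁ / f₀ * (x - x₀))
            D := fun u ↦ D₀ * Real.exp (D₁ / D₀ * (u - u₀))
            K := fun u ↦ K₀ + K₁ * (u - u₀) + (u - u₀) ^ 2
            isOpen_I := isOpen_univ
            isOpen_J := isOpen_univ
            isPreconnected_I := isPreconnected_univ
            isPreconnected_J := isPreconnected_univ
            smooth_f := by fun_prop
            smooth_D := by fun_prop
            smooth_K := by fun_prop
            f_ne_zero := fun x _ ↦ mul_ne_zero hf₀ (Real.exp_ne_zero _)
            D_ne_zero := fun u _ ↦ mul_ne_zero hD₀ (Real.exp_ne_zero _)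
            nonlinear := ?_ }, (t₀, x₀, u₀), ⟨Set.mem_univ _, Set.mem_univ _⟩, ?_, ?_, ?_, ?_⟩
  · by_cases hK₁ : K₁ = 0
    · exact ⟨u₀ + 1, Set.mem_univ _, .inr (by rw [(hK _).deriv]; simp [hK₁])⟩
    · exact ⟨u₀, Set.mem_univ _, .inr (by rw [(hK _).deriv]; simpa using hK₁)⟩
  · simp [Equation.lift]
  · exact (hasDerivAt_mul_exp hf₀).deriv.trans (by simp)
  · exact (hasDerivAt_mul_exp hD₀).deriv.trans (by simp)
  · exact (hK u₀).deriv.trans (by simp)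

end TestEquations

namespace IsEquivalence

variable {φ : Ext → Ext} {W : Set Ext} {z : Ext}

theorem contDiffAt (h : IsEquivalence φ W) (hW : IsOpen W) (hz : z ∈ W) : ContDiffAt ℝ ∞ φ z :=
  h.smooth.contDiffAt (hW.mem_nhds hz)

theorem apply_mem_regular (h : IsEquivalence φ W) (hz : z ∈ W) (hr : z ∈ regular) :
    φ z ∈ regular := by
  obtain ⟨θ, p, hp, rfl, -⟩ := exists_equation hr 0 0 0
  obtain ⟨θ', hθ'⟩ := h.maps_class θ p hp hz
  have hmap := hθ'.self_of_nhds
  rw [hmap.map_lift]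
  exact ⟨θ'.f_ne_zero _ hmap.mem_dom.1, θ'.D_ne_zero _ hmap.mem_dom.2⟩

end IsEquivalence

/-- The coefficients at a point of the extended space, for the value `D₁` of `D_u`. -/
def jetAt (z : Ext) (hz : z ∈ regular) (D₁ : ℝ) : CoefficientJet :=
  ⟨z.2.1, z.2.2.1, D₁, z.2.2.2, hz.1, hz.2⟩

section Extraction

variable {φ : Ext → Ext} {θ θ' : Equation} {p : Base}

theorem contDiffAt_induced (hp : p ∈ θ.dom) (hφ : ContDiffAt ℝ ∞ φ (θ.lift p)) :
    ContDiffAt ℝ ∞ (induced φ θ) p :=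
  (hφ.comp p (Equation.contDiffAt_lift hp)).fst

theorem fderiv_induced (hp : p ∈ θ.dom) (hφ : DifferentiableAt ℝ φ (θ.lift p)) :
    fderiv ℝ (induced φ θ) p = .fst ℝ Base (ℝ × ℝ × ℝ) ∘L fderiv ℝ φ (θ.lift p) ∘L
      liftDeriv (deriv θ.f p.2.1) (deriv θ.D p.2.2) (deriv θ.K p.2.2) :=
  (hφ.hasFDerivAt.comp p (Equation.hasFDerivAt_lift hp)).fst.fderiv

theorem exists_fderiv_fderiv_induced (hp : p ∈ θ.dom) (hφ : ContDiffAt ℝ ∞ φ (θ.lift p))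
    (w w' : Base) : ∃ e : ℝ × ℝ × ℝ, fderiv ℝ (fderiv ℝ (induced φ θ)) p w w' =
      (fderiv ℝ (fderiv ℝ φ) (θ.lift p) (fderiv ℝ θ.lift p w) (fderiv ℝ θ.lift p w')
        + fderiv ℝ φ (θ.lift p) (0, e)).1 := by
  have hφ₂ : ContDiffAt ℝ 2 φ (θ.lift p) := hφ.of_le ENat.LEInfty.out
  have hl₂ : ContDiffAt ℝ 2 θ.lift p := (Equation.contDiffAt_lift hp).of_le ENat.LEInfty.out
  refine ⟨(fderiv ℝ (fderiv ℝ θ.lift) p w w').2, ?_⟩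
  have hfst := fderiv_fderiv_comp (g := Prod.fst (α := Base) (β := ℝ × ℝ × ℝ)) (γ := φ ∘ θ.lift)
    contDiffAt_fst (hφ₂.comp p hl₂) w w'
  have hzero : fderiv ℝ (fderiv ℝ (Prod.fst (α := Base) (β := ℝ × ℝ × ℝ))) (φ (θ.lift p)) = 0 := by
    rw [show fderiv ℝ (Prod.fst (α := Base) (β := ℝ × ℝ × ℝ)) = fun _ ↦ .fst ℝ _ _ from
      funext fun _ ↦ fderiv_fst]
    simp
  have hlift : fderiv ℝ (fderiv ℝ θ.lift) p w w' = (0, (fderiv ℝ (fderiv ℝ θ.lift) p w w').2) :=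
    Prod.ext (Equation.fst_fderiv_fderiv_lift hp w w') rfl
  rw [Function.comp_apply, hzero, fderiv_fst, fderiv_fderiv_comp hφ₂ hl₂, hlift] at hfst
  exact hfst.trans (by simp)

theorem MapsEquationAt.fderiv_elements (h : ∀ᶠ q in 𝓝 p, MapsEquationAt φ θ θ' q)
    (hΨ : DifferentiableAt ℝ (induced φ θ) p) (hp : p ∈ θ.dom)
    (hφ : DifferentiableAt ℝ φ (θ.lift p)) (w : Base) :
    fderiv ℝ φ (θ.lift p) (fderiv ℝ θ.lift p w) =
      liftDeriv (deriv θ'.f (induced φ θ p).2.1) (deriv θ'.D (induced φ θ p).2.2)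
        (deriv θ'.K (induced φ θ p).2.2) (fderiv ℝ (induced φ θ) p w) := by
  have hl : DifferentiableAt ℝ θ.lift p := (Equation.hasFDerivAt_lift hp).differentiableAt
  have hl' := Equation.hasFDerivAt_lift h.self_of_nhds.mem_dom
  have heq : φ ∘ θ.lift =ᶠ[𝓝 p] θ'.lift ∘ induced φ θ := h.mono fun q hq ↦ hq.map_lift
  have hderiv := ((hφ.hasFDerivAt.comp p hl.hasFDerivAt).congr_of_eventuallyEq heq.symm).unique
    (hl'.comp p hΨ.hasFDerivAt)
  exact DFunLike.congr_fun hderiv w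

theorem IsEquivalence.exists_mapsJets {W : Set Ext} {z : Ext} (h : IsEquivalence φ W)
    (hW : IsOpen W) (hz : z ∈ W) (hr : z ∈ regular) (f₁ D₁ K₁ : ℝ) :
    ∃ (B : Base →L[ℝ] Base →L[ℝ] Base) (f₁' D₁' K₁' : ℝ),
      (∀ w, ∃ e : ℝ × ℝ × ℝ, B w w =
        (fderiv ℝ (fderiv ℝ φ) z (liftDeriv f₁ D₁ K₁ w) (liftDeriv f₁ D₁ K₁ w)
          + fderiv ℝ φ z (0, e)).1) ∧
      (∀ w, fderiv ℝ φ z (liftDeriv f₁ D₁ K₁ w) =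
        liftDeriv f₁' D₁' K₁' (fderiv ℝ φ z (liftDeriv f₁ D₁ K₁ w)).1) ∧
      MapsJets (.fst ℝ Base (ℝ × ℝ × ℝ) ∘L fderiv ℝ φ z ∘L liftDeriv f₁ D₁ K₁) B
        (jetAt z hr D₁) (jetAt (φ z) (h.apply_mem_regular hz hr) D₁') := by
  obtain ⟨θ, p, hp, rfl, rfl, rfl, rfl⟩ := exists_equation hr f₁ D₁ K₁
  have hφ := h.contDiffAt hW hz
  obtain ⟨θ', hθ'⟩ := h.maps_class θ _ hp hz
  have hmap := hθ'.self_of_nhds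
  have hΨ := contDiffAt_induced hp hφ
  have hφ₁ := hφ.differentiableAt (by simp)
  have hderiv := fderiv_induced hp hφ₁
  have hlift := (Equation.hasFDerivAt_lift hp).fderiv
  refine ⟨fderiv ℝ (fderiv ℝ (induced φ θ)) p, deriv θ'.f (induced φ θ p).2.1,
    deriv θ'.D (induced φ θ p).2.2, deriv θ'.K (induced φ θ p).2.2, fun w ↦ ?_, fun w ↦ ?_, ?_⟩
  · rw [← hlift]
    exact exists_fderiv_fderiv_induced hp hφ w w
  · have := MapsEquationAt.fderiv_elements hθ' (hΨ.differentiableAt (by simp)) hp hφ₁ w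
    rwa [hlift, hderiv] at this
  · have hjet : jetAt (φ (θ.lift p)) (h.apply_mem_regular hz hr)
        (deriv θ'.D (induced φ θ p).2.2) = θ'.jet _ hmap.mem_dom := by
      simp only [jetAt, hmap.map_lift]; rfl
    have := hmap.mapsJets hp hΨ
    rwa [← hjet, hderiv] at this

end Extraction

section Coordinates

/-- The names of the coordinates `(t, x, u, f, D, K)` of the extended space. -/
inductive Coord
  | t | x | u | f | D | K

/-- The coordinate functions of the extended space. -/
def coord : Coord → Ext →L[ℝ] ℝ
  | .t => .fst ℝ ℝ (ℝ × ℝ) ∘L .fst ℝ Base (ℝ × ℝ × ℝ)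
  | .x => .fst ℝ ℝ ℝ ∘L .snd ℝ ℝ (ℝ × ℝ) ∘L .fst ℝ Base (ℝ × ℝ × ℝ)
  | .u => .snd ℝ ℝ ℝ ∘L .snd ℝ ℝ (ℝ × ℝ) ∘L .fst ℝ Base (ℝ × ℝ × ℝ)
  | .f => .fst ℝ ℝ (ℝ × ℝ) ∘L .snd ℝ Base (ℝ × ℝ × ℝ)
  | .D => .fst ℝ ℝ ℝ ∘L .snd ℝ ℝ (ℝ × ℝ) ∘L .snd ℝ Base (ℝ × ℝ × ℝ)
  | .K => .snd ℝ ℝ ℝ ∘L .snd ℝ ℝ (ℝ × ℝ) ∘L .snd ℝ Base (ℝ × ℝ × ℝ)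

/-- The coordinate vectors of the extended space. -/
def vec : Coord → Ext
  | .t => ((1, 0, 0), (0, 0, 0))
  | .x => ((0, 1, 0), (0, 0, 0))
  | .u => ((0, 0, 1), (0, 0, 0))
  | .f => ((0, 0, 0), (1, 0, 0))
  | .D => ((0, 0, 0), (0, 1, 0))
  | .K => ((0, 0, 0), (0, 0, 1))

theorem ext_coord {v w : Ext} (h : ∀ i, coord i v = coord i w) : v = w :=
  Prod.ext (Prod.ext (h .t) (Prod.ext (h .x) (h .u)))
    (Prod.ext (h .f) (Prod.ext (h .D) (h .K)))

theorem coord_vec_self (i : Coord) : coord i (vec i) = 1 := by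
  cases i <;> rfl

theorem coord_vec_of_ne {i j : Coord} (h : i ≠ j) : coord i (vec j) = 0 := by
  cases i <;> cases j <;> first | rfl | exact absurd rfl h

theorem map_eq_sum_coord (ℓ : Ext →L[ℝ] ℝ) (v : Ext) :
    ℓ v = coord .t v * ℓ (vec .t) + coord .x v * ℓ (vec .x) + coord .u v * ℓ (vec .u)
      + coord .f v * ℓ (vec .f) + coord .D v * ℓ (vec .D) + coord .K v * ℓ (vec .K) := by
  have hv : v = coord .t v • vec .t + coord .x v • vec .x + coord .u v • vec .u
      + coord .f v • vec .f + coord .D v • vec .D + coord .K v • vec .K := by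
    refine ext_coord fun i ↦ ?_
    cases i <;> simp [vec, coord]
  conv_lhs => rw [hv]
  simp only [map_add, map_smul, smul_eq_mul]

theorem liftDeriv_et (f₁ D₁ K₁ : ℝ) : liftDeriv f₁ D₁ K₁ et = vec .t := by
  simp [liftDeriv_apply, vec]

theorem liftDeriv_ex (f₁ D₁ K₁ : ℝ) : liftDeriv f₁ D₁ K₁ ex = vec .x + f₁ • vec .f := by
  simp [liftDeriv_apply, vec]

theorem liftDeriv_eu (f₁ D₁ K₁ : ℝ) :
    liftDeriv f₁ D₁ K₁ eu = vec .u + D₁ • vec .D + K₁ • vec .K := by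
  simp [liftDeriv_apply, vec]

/-- The entries of the Jacobian matrix of a transformation of the extended space. -/
def jac (φ : Ext → Ext) (i j : Coord) (z : Ext) : ℝ := coord i (fderiv ℝ φ z (vec j))

/-- The diagonal second partial derivatives of a transformation of the extended space. -/
def hess (φ : Ext → Ext) (i : Coord) (z : Ext) : ℝ :=
  coord i (fderiv ℝ (fderiv ℝ φ) z (vec i) (vec i))

variable {φ : Ext → Ext} {W : Set Ext} {z : Ext} {i : Coord}

theorem coord_fderiv (hrow : ∀ j ≠ i, jac φ i j z = 0) (v : Ext) :
    coord i (fderiv ℝ φ z v) = coord i v * jac φ i i z := by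
  have h := map_eq_sum_coord (coord i ∘L fderiv ℝ φ z) v
  have hrow' (j : Coord) (hj : j ≠ i) : coord i (fderiv ℝ φ z (vec j)) = 0 := hrow j hj
  cases i <;> simpa [jac, hrow'] using h

theorem hasFDerivAt_coord_comp (hφ : ContDiffAt ℝ ∞ φ z) (i : Coord) :
    HasFDerivAt (fun y ↦ coord i (φ y)) (coord i ∘L fderiv ℝ φ z) z :=
  (coord i).hasFDerivAt.comp z (hφ.differentiableAt (by simp)).hasFDerivAt

-- Each row of the Jacobian matrix is differentiated along the open set where it is known.
theorem coord_fderiv_fderiv (hW : IsOpen W) (hφ : ContDiffOn ℝ ∞ φ W)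
    (hrow : ∀ y ∈ W, ∀ j ≠ i, jac φ i j y = 0) (hz : z ∈ W) (v w : Ext) :
    coord i (fderiv ℝ (fderiv ℝ φ) z v w) = coord i v * coord i w * hess φ i z := by
  have hφ₂ : ContDiffAt ℝ 2 φ z := (hφ.contDiffAt (hW.mem_nhds hz)).of_le ENat.LEInfty.out
  have hright (v w : Ext) : coord i (fderiv ℝ (fderiv ℝ φ) z v w) =
      coord i w * coord i (fderiv ℝ (fderiv ℝ φ) z v (vec i)) := by
    have hlin : (fun y ↦ coord i (fderiv ℝ φ y w)) =ᶠ[𝓝 z] fun y ↦ coord i w * jac φ i i y :=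
      Filter.eventually_of_mem (hW.mem_nhds hz) fun y hy ↦ coord_fderiv (hrow y hy) w
    have heq := (hasFDerivAt_clm_fderiv_apply hφ₂ (coord i) w).unique
      (((hasFDerivAt_clm_fderiv_apply hφ₂ (coord i) (vec i)).const_mul
        (coord i w)).congr_of_eventuallyEq hlin)
    exact DFunLike.congr_fun heq v
  rw [hright, fderiv_fderiv_comm hφ₂, hright, hess]
  ring

theorem hasFDerivAt_jac_self (hW : IsOpen W) (hφ : ContDiffOn ℝ ∞ φ W)
    (hrow : ∀ y ∈ W, ∀ j ≠ i, jac φ i j y = 0) (hz : z ∈ W) :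
    HasFDerivAt (jac φ i i) (hess φ i z • coord i) z := by
  have hφ₂ : ContDiffAt ℝ 2 φ z := (hφ.contDiffAt (hW.mem_nhds hz)).of_le ENat.LEInfty.out
  refine (hasFDerivAt_clm_fderiv_apply hφ₂ (coord i) (vec i)).congr_fderiv
    (ContinuousLinearMap.ext fun v ↦ ?_)
  change coord i (fderiv ℝ (fderiv ℝ φ) z v (vec i)) = hess φ i z * coord i v
  rw [coord_fderiv_fderiv hW hφ hrow hz, coord_vec_self]
  ring

theorem contDiffAt_jac (hφ : ContDiffAt ℝ ∞ φ z) (i j : Coord) :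
    ContDiffAt ℝ ∞ (jac φ i j) z :=
  (coord i).contDiff.contDiffAt.comp z ((hφ.fderiv_right (m := ∞) (by simp)).clm_apply
    contDiffAt_const)

-- The mixed second derivatives of `jac φ i i` vanish because `jac φ i i` depends on the `i`-th
-- coordinate alone.
theorem exists_hasFDerivAt_hess (hW : IsOpen W) (hφ : ContDiffOn ℝ ∞ φ W)
    (hrow : ∀ y ∈ W, ∀ j ≠ i, jac φ i j y = 0) (hz : z ∈ W) :
    ∃ L : Ext →L[ℝ] ℝ, HasFDerivAt (hess φ i) L z ∧ ∀ v, coord i v = 0 → L v = 0 := by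
  have hjac : ContDiffAt ℝ 2 (jac φ i i) z :=
    (contDiffAt_jac (hφ.contDiffAt (hW.mem_nhds hz)) i i).of_le ENat.LEInfty.out
  have hderiv (v : Ext) : ∀ᶠ y in 𝓝 z, fderiv ℝ (jac φ i i) y v = hess φ i y * coord i v :=
    Filter.eventually_of_mem (hW.mem_nhds hz) fun y hy ↦
      DFunLike.congr_fun (hasFDerivAt_jac_self hW hφ hrow hy).fderiv v
  have hsecond (v : Ext) := hasFDerivAt_clm_fderiv_apply hjac (.id ℝ ℝ) v
  refine ⟨_, (hsecond (vec i)).congr_of_eventuallyEq ?_, fun v hv ↦ ?_⟩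
  · filter_upwards [hderiv (vec i)] with y hy
    rw [ContinuousLinearMap.id_apply, hy, coord_vec_self, mul_one]
  · have hzero := (hsecond v).unique ((hasFDerivAt_const (0 : ℝ) z).congr_of_eventuallyEq <| by
      filter_upwards [hderiv v] with y hy
      rw [ContinuousLinearMap.id_apply, hy, hv, mul_zero])
    exact (fderiv_fderiv_comm hjac v (vec i)).trans (DFunLike.congr_fun hzero (vec i))

theorem linear_eq_zero {a b : ℝ} (h : ∀ r : ℝ, a + r * b = 0) : a = 0 ∧ b = 0 := by
  have h₀ := h 0
  have h₁ := h 1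
  exact ⟨by linarith, by linarith⟩

theorem affine_eq_zero {a b c : ℝ} (h : ∀ r s : ℝ, a + r * b + s * c = 0) :
    a = 0 ∧ b = 0 ∧ c = 0 := by
  have h₀ := h 0 0
  have h₁ := h 1 0
  have h₂ := h 0 1
  exact ⟨by linarith, by linarith, by linarith⟩

theorem linear_ne_zero {a b : ℝ} (h : ∀ r : ℝ, a + r * b ≠ 0) : a ≠ 0 ∧ b = 0 := by
  refine ⟨fun ha ↦ h 0 (by simp [ha]), ?_⟩
  by_contra hb
  exact h (-a / b) (by field_simp; ring)

theorem affine_ne_zero {a b c : ℝ} (h : ∀ r s : ℝ, a + r * b + s * c ≠ 0) :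
    a ≠ 0 ∧ b = 0 ∧ c = 0 := by
  refine ⟨fun ha ↦ h 0 0 (by simp [ha]), ?_, ?_⟩
  · by_contra hb
    exact h (-a / b) 0 (by field_simp; ring)
  · by_contra hc
    exact h 0 (-a / c) (by field_simp; ring)

end Coordinates

namespace IsEquivalence

variable {φ : Ext → Ext} {W : Set Ext} {z : Ext}

section FirstOrder

variable (h : IsEquivalence φ W) (hW : IsOpen W) (hr : W ⊆ regular) (hz : z ∈ W)

include h hz in
theorem exists_jac_ne_zero (j : Coord) : ∃ i, jac φ i j z ≠ 0 := by
  by_contra! hcol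
  have hvec : vec j = 0 := (h.bijective_fderiv z hz).1 <| by
    rw [map_zero]
    exact ext_coord fun i ↦ by simpa [jac] using hcol i
  simpa [hvec] using coord_vec_self j

include h hW hr hz

theorem jac_t_self_ne_zero : jac φ .t .t z ≠ 0 := by
  obtain ⟨B, _, _, _, -, -, hjet⟩ := h.exists_mapsJets hW hz (hr hz) 0 0 0
  simpa [liftDeriv_et, jac, coord] using hjet.time_t_ne_zero

theorem jac_t_eq_zero (j : Coord) (hj : j ≠ .t) : jac φ .t j z = 0 := by
  have hu : jac φ .t .u z = 0 ∧ jac φ .t .D z = 0 ∧ jac φ .t .K z = 0 :=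
    affine_eq_zero fun D₁ K₁ ↦ by
      obtain ⟨B, _, _, _, -, -, hjet⟩ := h.exists_mapsJets hW hz (hr hz) 0 D₁ K₁
      simpa [liftDeriv_eu, jac, coord] using hjet.time_u_eq_zero
  have hx : jac φ .t .x z = 0 ∧ jac φ .t .f z = 0 := linear_eq_zero fun f₁ ↦ by
    obtain ⟨B, _, _, _, -, -, hjet⟩ := h.exists_mapsJets hW hz (hr hz) f₁ 0 0
    simpa [liftDeriv_ex, jac, coord] using hjet.time_x_eq_zero
  cases j
  exacts [absurd rfl hj, hx.1, hu.1, hx.2, hu.2.1, hu.2.2]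

theorem fst_secondDeriv_eq_zero {f₁ D₁ K₁ : ℝ} {B : Base →L[ℝ] Base →L[ℝ] Base}
    (hB : ∀ w, ∃ e : ℝ × ℝ × ℝ, B w w =
      (fderiv ℝ (fderiv ℝ φ) z (liftDeriv f₁ D₁ K₁ w) (liftDeriv f₁ D₁ K₁ w)
        + fderiv ℝ φ z (0, e)).1) (b : ℝ) : (B (0, 1, b) (0, 1, b)).1 = 0 := by
  obtain ⟨e, he⟩ := hB (0, 1, b)
  have hrow (y : Ext) (hy : y ∈ W) (j : Coord) (hj : j ≠ .t) : jac φ .t j y = 0 :=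
    h.jac_t_eq_zero hW hr hy j hj
  rw [he]
  change coord .t (_ + _) = 0
  rw [map_add, coord_fderiv_fderiv hW h.smooth hrow hz, coord_fderiv (hrow z hz)]
  simp [coord, liftDeriv_apply]

theorem jac_x_row : jac φ .x .x z ≠ 0 ∧ jac φ .x .f z = 0 ∧
    jac φ .x .u z = 0 ∧ jac φ .x .D z = 0 ∧ jac φ .x .K z = 0 := by
  have hx : jac φ .x .x z ≠ 0 ∧ jac φ .x .f z = 0 := linear_ne_zero fun f₁ ↦ by
    obtain ⟨B, _, _, _, hB, -, hjet⟩ := h.exists_mapsJets hW hz (hr hz) f₁ 0 0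
    simpa [liftDeriv_ex, jac, coord] using
      hjet.space_x_ne_zero (h.fst_secondDeriv_eq_zero hW hr hz hB)
  have hu : jac φ .x .u z = 0 ∧ jac φ .x .D z = 0 ∧ jac φ .x .K z = 0 :=
    affine_eq_zero fun D₁ K₁ ↦ by
      obtain ⟨B, _, _, _, hB, -, hjet⟩ := h.exists_mapsJets hW hz (hr hz) 0 D₁ K₁
      simpa [liftDeriv_eu, jac, coord] using
        hjet.space_u_eq_zero (h.fst_secondDeriv_eq_zero hW hr hz hB)
  exact ⟨hx.1, hx.2, hu⟩

theorem jac_u_row : jac φ .u .u z ≠ 0 ∧ jac φ .u .D z = 0 ∧ jac φ .u .K z = 0 :=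
  affine_ne_zero fun D₁ K₁ ↦ by
    obtain ⟨B, _, _, _, hB, -, hjet⟩ := h.exists_mapsJets hW hz (hr hz) 0 D₁ K₁
    simpa [liftDeriv_eu, jac, coord] using
      hjet.state_u_ne_zero (h.fst_secondDeriv_eq_zero hW hr hz hB)

theorem exists_slopes (f₁ D₁ K₁ : ℝ) : ∃ f₁' D₁' K₁' : ℝ, ∀ w,
    coord .f (fderiv ℝ φ z (liftDeriv f₁ D₁ K₁ w)) =
      f₁' * coord .x (fderiv ℝ φ z (liftDeriv f₁ D₁ K₁ w)) ∧
    coord .D (fderiv ℝ φ z (liftDeriv f₁ D₁ K₁ w)) =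
      D₁' * coord .u (fderiv ℝ φ z (liftDeriv f₁ D₁ K₁ w)) ∧
    coord .K (fderiv ℝ φ z (liftDeriv f₁ D₁ K₁ w)) =
      K₁' * coord .u (fderiv ℝ φ z (liftDeriv f₁ D₁ K₁ w)) := by
  obtain ⟨B, f₁', D₁', K₁', -, hslope, -⟩ := h.exists_mapsJets hW hz (hr hz) f₁ D₁ K₁
  exact ⟨f₁', D₁', K₁', fun w ↦ ⟨congrArg (coord .f) (hslope w), congrArg (coord .D) (hslope w),
    congrArg (coord .K) (hslope w)⟩⟩

theorem jac_f_of_state : jac φ .f .u z = 0 ∧ jac φ .f .D z = 0 ∧ jac φ .f .K z = 0 :=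
  affine_eq_zero fun D₁ K₁ ↦ by
    obtain ⟨-, -, hxu, hxD, hxK⟩ := h.jac_x_row hW hr hz
    obtain ⟨f₁', D₁', K₁', hslope⟩ := h.exists_slopes hW hr hz 0 D₁ K₁
    have := (hslope eu).1
    simp only [liftDeriv_eu, map_add, map_smul, smul_eq_mul, ← jac.eq_def] at this
    rw [this, hxu, hxD, hxK]
    ring

-- The image of `v` is determined by `v`, while the slopes `D_u`, `K_u` of the graph are free: its
-- `u`-component must vanish, since otherwise the whole `D`-column of the Jacobian matrix would.
theorem coord_state_eq_zero {f₁ : ℝ} {w : Base} {v : Ext}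
    (hv : ∀ D₁ K₁, liftDeriv f₁ D₁ K₁ w = v) :
    coord .u (fderiv ℝ φ z v) = 0 ∧ coord .D (fderiv ℝ φ z v) = 0 ∧
      coord .K (fderiv ℝ φ z v) = 0 := by
  obtain ⟨huu, huD, huK⟩ := h.jac_u_row hW hr hz
  set a := coord .u (fderiv ℝ φ z v)
  have hrow (i : Coord) (hi : i = .D ∨ i = .K) :
      a * jac φ i .u z - coord i (fderiv ℝ φ z v) * jac φ .u .u z = 0 ∧
        a * jac φ i .D z = 0 ∧ a * jac φ i .K z = 0 := affine_eq_zero fun D₁ K₁ ↦ by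
    obtain ⟨_, D₁', K₁', hslope⟩ := h.exists_slopes hW hr hz f₁ D₁ K₁
    have hw := hslope w
    have heu := hslope eu
    rw [hv] at hw
    simp only [liftDeriv_eu, map_add, map_smul, smul_eq_mul, ← jac.eq_def, huD, huK, mul_zero,
      add_zero] at heu
    rcases hi with rfl | rfl
    · linear_combination a * heu.2.1 - jac φ .u .u z * hw.2.1
    · linear_combination a * heu.2.2 - jac φ .u .u z * hw.2.2
  have ha : a = 0 := by
    by_contra ha
    obtain ⟨i, hi⟩ := h.exists_jac_ne_zero hz .D
    refine hi ?_
    cases i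
    exacts [h.jac_t_eq_zero hW hr hz _ (by simp), (h.jac_x_row hW hr hz).2.2.2.1, huD,
      (h.jac_f_of_state hW hr hz).2.1, (mul_eq_zero.mp (hrow .D (.inl rfl)).2.1).resolve_left ha,
      (mul_eq_zero.mp (hrow .K (.inr rfl)).2.1).resolve_left ha]
  have hzero (i : Coord) (hi : i = .D ∨ i = .K) : coord i (fderiv ℝ φ z v) = 0 := by
    simpa [ha, huu] using (hrow i hi).1
  exact ⟨ha, hzero .D (.inl rfl), hzero .K (.inr rfl)⟩

theorem jac_state_eq_zero {i : Coord} (hi : i = .u ∨ i = .D ∨ i = .K) :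
    jac φ i .t z = 0 ∧ jac φ i .x z = 0 ∧ jac φ i .f z = 0 := by
  have ht := h.coord_state_eq_zero hW hr hz (liftDeriv_et 0)
  have hx : jac φ i .x z = 0 ∧ jac φ i .f z = 0 := linear_eq_zero fun f₁ ↦ by
    have hx := h.coord_state_eq_zero hW hr hz (liftDeriv_ex f₁)
    simp only [map_add, map_smul, smul_eq_mul, ← jac.eq_def] at hx
    rcases hi with rfl | rfl | rfl
    exacts [by linarith [hx.1], by linarith [hx.2.1], by linarith [hx.2.2]]
  refine ⟨?_, hx⟩
  rcases hi with rfl | rfl | rfl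
  exacts [ht.1, ht.2.1, ht.2.2]

theorem jac_u_eq_zero (j : Coord) (hj : j ≠ .u) : jac φ .u j z = 0 := by
  obtain ⟨ht, hx, hf⟩ := h.jac_state_eq_zero hW hr hz (i := .u) (.inl rfl)
  obtain ⟨-, hD, hK⟩ := h.jac_u_row hW hr hz
  cases j
  exacts [ht, hx, absurd rfl hj, hf, hD, hK]

theorem jac_f_self_ne_zero : jac φ .f .f z ≠ 0 := by
  obtain ⟨i, hi⟩ := h.exists_jac_ne_zero hz .f
  cases i
  case f => exact hi
  case t => exact absurd (h.jac_t_eq_zero hW hr hz _ (by simp)) hi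
  case x => exact absurd (h.jac_x_row hW hr hz).2.1 hi
  all_goals exact absurd (h.jac_state_eq_zero hW hr hz (by simp)).2.2 hi

theorem jac_x_t_eq_zero : jac φ .x .t z = 0 := by
  obtain ⟨-, hxf, -⟩ := h.jac_x_row hW hr hz
  have hprod : jac φ .f .x z * jac φ .x .t z - jac φ .f .t z * jac φ .x .x z = 0 ∧
      jac φ .f .f z * jac φ .x .t z = 0 := linear_eq_zero fun f₁ ↦ by
    obtain ⟨f₁', _, _, hslope⟩ := h.exists_slopes hW hr hz f₁ 0 0
    have ht := (hslope et).1
    have hx := (hslope ex).1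
    simp only [liftDeriv_et, liftDeriv_ex, map_add, map_smul, smul_eq_mul, ← jac.eq_def, hxf,
      mul_zero, add_zero] at ht hx
    linear_combination jac φ .x .t z * hx - jac φ .x .x z * ht
  exact (mul_eq_zero.mp hprod.2).resolve_left (h.jac_f_self_ne_zero hW hr hz)

theorem jac_x_eq_zero (j : Coord) (hj : j ≠ .x) : jac φ .x j z = 0 := by
  obtain ⟨-, hf, hu, hD, hK⟩ := h.jac_x_row hW hr hz
  cases j
  exacts [h.jac_x_t_eq_zero hW hr hz, absurd rfl hj, hu, hf, hD, hK]

end FirstOrder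

section SecondOrder

variable (h : IsEquivalence φ W) (hW : IsOpen W) (hr : W ⊆ regular) (hz : z ∈ W)
include h hW hr hz

theorem fst_fderiv_liftDeriv (f₁ D₁ K₁ : ℝ) (w : Base) :
    (fderiv ℝ φ z (liftDeriv f₁ D₁ K₁ w)).1 =
      (jac φ .t .t z * w.1, jac φ .x .x z * w.2.1, jac φ .u .u z * w.2.2) :=
  Prod.ext ((coord_fderiv (h.jac_t_eq_zero hW hr hz) _).trans (mul_comm ..)) <|
    Prod.ext ((coord_fderiv (h.jac_x_eq_zero hW hr hz) _).trans (mul_comm ..))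
      ((coord_fderiv (h.jac_u_eq_zero hW hr hz) _).trans (mul_comm ..))

theorem secondDeriv_slope {f₁ D₁ K₁ : ℝ} {B : Base →L[ℝ] Base →L[ℝ] Base}
    (hB : ∀ w, ∃ e : ℝ × ℝ × ℝ, B w w =
      (fderiv ℝ (fderiv ℝ φ) z (liftDeriv f₁ D₁ K₁ w) (liftDeriv f₁ D₁ K₁ w)
        + fderiv ℝ φ z (0, e)).1) (b : ℝ) :
    B (0, 1, b) (0, 1, b) = (0, hess φ .x z, b ^ 2 * hess φ .u z) := by
  obtain ⟨e, he⟩ := hB (0, 1, b)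
  have hcoord {i : Coord} (hi : ∀ y ∈ W, ∀ j ≠ i, jac φ i j y = 0) (v : Ext) :
      coord i (fderiv ℝ (fderiv ℝ φ) z v v + fderiv ℝ φ z (0, e)) =
        coord i v ^ 2 * hess φ i z + coord i ((0, e) : Ext) * jac φ i i z := by
    rw [map_add, coord_fderiv_fderiv hW h.smooth hi hz, coord_fderiv (hi z hz), sq]
  have ht := hcoord (fun y ↦ h.jac_t_eq_zero hW hr) (liftDeriv f₁ D₁ K₁ (0, 1, b))
  have hx := hcoord (fun y ↦ h.jac_x_eq_zero hW hr) (liftDeriv f₁ D₁ K₁ (0, 1, b))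
  have hu := hcoord (fun y ↦ h.jac_u_eq_zero hW hr) (liftDeriv f₁ D₁ K₁ (0, 1, b))
  rw [he]
  exact Prod.ext (ht.trans (by simp [coord, liftDeriv_apply]))
    (Prod.ext (hx.trans (by simp [coord, liftDeriv_apply]))
      (hu.trans (by simp [coord, liftDeriv_apply])))

theorem leading : coord .f z * coord .D (φ z) * jac φ .t .t z =
    coord .f (φ z) * coord .D z * jac φ .x .x z ^ 2 := by
  obtain ⟨B, _, _, _, hB, -, hjet⟩ := h.exists_mapsJets hW hz (hr hz) 0 0 0
  simpa [liftDeriv_et, liftDeriv_ex, jetAt, jac, coord] using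
    hjet.leading (h.fst_secondDeriv_eq_zero hW hr hz hB)

theorem convection : coord .D (φ z) * (coord .D z * hess φ .x z + coord .K z * jac φ .x .x z) =
    coord .D z * coord .K (φ z) * jac φ .x .x z ^ 2 := by
  obtain ⟨B, _, _, _, hB, -, hjet⟩ := h.exists_mapsJets hW hz (hr hz) 0 0 0
  exact hjet.convection (h.fst_fderiv_liftDeriv hW hr hz 0 0 0) (h.secondDeriv_slope hW hr hz hB)

theorem diffusion :
    coord .D (φ z) * hess φ .u z + jac φ .u .u z * jac φ .D .u z = 0 ∧
      coord .D z * jac φ .D .D z = coord .D (φ z) ∧ jac φ .D .K z = 0 := by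
  have hU := (h.jac_u_row hW hr hz).1
  have hD : coord .D z ≠ 0 := (hr hz).2
  have haffine :
      coord .D z * (coord .D (φ z) * hess φ .u z + jac φ .u .u z * jac φ .D .u z) = 0 ∧
      jac φ .u .u z * (coord .D z * jac φ .D .D z - coord .D (φ z)) = 0 ∧
      coord .D z * jac φ .u .u z * jac φ .D .K z = 0 := affine_eq_zero fun D₁ K₁ ↦ by
    obtain ⟨B, f₁', D₁', K₁', hB, hslope, hjet⟩ := h.exists_mapsJets hW hz (hr hz) 0 D₁ K₁
    have hdiff : D₁ * coord .D (φ z) * jac φ .u .u z =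
        coord .D z * (coord .D (φ z) * hess φ .u z + D₁' * jac φ .u .u z ^ 2) :=
      hjet.diffusion (h.fst_fderiv_liftDeriv hW hr hz 0 D₁ K₁) (h.secondDeriv_slope hW hr hz hB)
    have hDrow : coord .D (fderiv ℝ φ z (liftDeriv 0 D₁ K₁ eu)) = D₁' * jac φ .u .u z := by
      rw [hslope, h.fst_fderiv_liftDeriv hW hr hz]
      simp [coord, liftDeriv_apply]
    simp only [liftDeriv_eu, map_add, map_smul, smul_eq_mul, ← jac.eq_def] at hDrow
    linear_combination (coord .D z * jac φ .u .u z) * hDrow - hdiff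
  obtain ⟨hu, hDD, hDK⟩ := haffine
  exact ⟨by simpa [hD] using hu, by simpa [hU, sub_eq_zero] using hDD, by simpa [hD, hU] using hDK⟩

end SecondOrder

section Constants

variable (h : IsEquivalence φ W) (hW : IsOpen W) (hr : W ⊆ regular) (hz : z ∈ W)
include h hW hr hz

theorem fderiv_leading (v : Ext) :
    (coord .f v * coord .D (φ z) + coord .f z * coord .D (fderiv ℝ φ z v)) * jac φ .t .t z
        + coord .f z * coord .D (φ z) * (hess φ .t z * coord .t v) =
      (coord .f (fderiv ℝ φ z v) * coord .D z + coord .f (φ z) * coord .D v) * jac φ .x .x z ^ 2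
        + coord .f (φ z) * coord .D z * (2 * jac φ .x .x z * (hess φ .x z * coord .x v)) := by
  have hφ := h.contDiffAt hW hz
  have hT := hasFDerivAt_jac_self hW h.smooth (fun y ↦ h.jac_t_eq_zero hW hr) hz
  have hX := hasFDerivAt_jac_self hW h.smooth (fun y ↦ h.jac_x_eq_zero hW hr) hz
  have hleft := ((coord .f).hasFDerivAt.mul (hasFDerivAt_coord_comp hφ .D)).mul hT
  have hright := ((hasFDerivAt_coord_comp hφ .f).mul (coord .D).hasFDerivAt).mul (hX.pow 2)
  have heq := hleft.unique (hright.congr_of_eventuallyEq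
    (Filter.eventually_of_mem (hW.mem_nhds hz) fun y hy ↦ h.leading hW hr hy))
  have := DFunLike.congr_fun heq v
  simp only [Pi.mul_apply, smul_add, add_apply, smul_apply, smul_eq_mul,
    ContinuousLinearMap.comp_apply, Nat.add_one_sub_one, pow_one, nsmul_eq_mul,
    Nat.cast_ofNat] at this
  linear_combination this

theorem jac_D_u_eq_zero : jac φ .D .u z = 0 := by
  have := h.fderiv_leading hW hr hz (vec .u)
  rw [← jac.eq_def, ← jac.eq_def, (h.jac_f_of_state hW hr hz).1] at this
  simp only [coord_vec_of_ne, ne_eq, reduceCtorEq, not_false_eq_true, zero_mul, mul_zero, zero_add,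
    add_zero, mul_eq_zero, (h.jac_t_self_ne_zero hW hr hz), or_false] at this
  exact this.resolve_left (hr hz).1

theorem hess_t_eq_zero : hess φ .t z = 0 := by
  have hD : coord .D (φ z) ≠ 0 := (h.apply_mem_regular hz (hr hz)).2
  have hf : coord .f z ≠ 0 := (hr hz).1
  have hft : jac φ .f .t z = 0 := by
    obtain ⟨f₁', _, _, hslope⟩ := h.exists_slopes hW hr hz 0 0 0
    have := (hslope et).1
    rwa [liftDeriv_et, ← jac.eq_def, ← jac.eq_def, h.jac_x_t_eq_zero hW hr hz, mul_zero] at this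
  have := h.fderiv_leading hW hr hz (vec .t)
  rw [← jac.eq_def, ← jac.eq_def, hft, (h.jac_state_eq_zero hW hr hz (by simp)).1] at this
  simpa [coord_vec_of_ne, coord_vec_self, hf, hD] using this

theorem hess_u_eq_zero : hess φ .u z = 0 := by
  have hD : coord .D (φ z) ≠ 0 := (h.apply_mem_regular hz (hr hz)).2
  have := (h.diffusion hW hr hz).1
  rwa [h.jac_D_u_eq_zero hW hr hz, mul_zero, add_zero, mul_eq_zero, or_iff_right hD] at this

theorem jac_D_eq_zero (j : Coord) (hj : j ≠ .D) : jac φ .D j z = 0 := by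
  obtain ⟨ht, hx, hf⟩ := h.jac_state_eq_zero hW hr hz (i := .D) (by simp)
  cases j
  exacts [ht, hx, h.jac_D_u_eq_zero hW hr hz, hf, absurd rfl hj, (h.diffusion hW hr hz).2.2]

theorem jac_K_self_mul_jac_x_self :
    coord .D z * jac φ .K .K z * jac φ .x .x z = coord .D (φ z) := by
  have hφ := h.contDiffAt hW hz
  have hrow (y : Ext) (hy : y ∈ W) : ∀ j ≠ .x, jac φ .x j y = 0 := h.jac_x_eq_zero hW hr hy
  have hX := hasFDerivAt_jac_self hW h.smooth hrow hz
  obtain ⟨L, hH, hL⟩ := exists_hasFDerivAt_hess hW h.smooth hrow hz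
  have hleft := (hasFDerivAt_coord_comp hφ .D).mul
    (((coord .D).hasFDerivAt.mul hH).add ((coord .K).hasFDerivAt.mul hX))
  have hright := ((coord .D).hasFDerivAt.mul (hasFDerivAt_coord_comp hφ .K)).mul (hX.pow 2)
  have heq := hleft.unique (hright.congr_of_eventuallyEq
    (Filter.eventually_of_mem (hW.mem_nhds hz) fun y hy ↦ h.convection hW hr hy))
  have := DFunLike.congr_fun heq (vec .K)
  simp only [smul_add, Pi.add_apply, Pi.mul_apply, add_apply, smul_apply, ne_eq, reduceCtorEq,
    not_false_eq_true, coord_vec_of_ne, hL, smul_eq_mul, mul_zero, add_zero, coord_vec_self,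
    mul_one, zero_add, ContinuousLinearMap.comp_apply, ← jac.eq_def, h.jac_D_eq_zero hW hr hz,
    Nat.add_one_sub_one, pow_one, nsmul_eq_mul, Nat.cast_ofNat] at this
  refine mul_left_cancel₀ (h.jac_x_row hW hr hz).1 ?_
  linear_combination -this

-- `K̃` does not depend on `x`, so neither does its derivative with respect to `K`.
theorem hess_x_eq_zero : hess φ .x z = 0 := by
  have hφ := h.contDiffAt hW hz
  have hφ₂ : ContDiffAt ℝ 2 φ z := hφ.of_le ENat.LEInfty.out
  have hD : coord .D (φ z) ≠ 0 := (h.apply_mem_regular hz (hr hz)).2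
  have hrel := h.jac_K_self_mul_jac_x_self hW hr hz
  have hKK := hasFDerivAt_clm_fderiv_apply hφ₂ (coord .K) (vec .K)
  have hKx := (hasFDerivAt_clm_fderiv_apply hφ₂ (coord .K) (vec .x)).unique
    ((hasFDerivAt_const (0 : ℝ) z).congr_of_eventuallyEq <| Filter.eventually_of_mem
      (hW.mem_nhds hz) fun y hy ↦ (h.jac_state_eq_zero hW hr hy (i := .K) (by simp)).2.1)
  have hmixed : coord .K (fderiv ℝ (fderiv ℝ φ) z (vec .x) (vec .K)) = 0 := by
    rw [fderiv_fderiv_comm hφ₂]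
    exact DFunLike.congr_fun hKx (vec .K)
  have hX := hasFDerivAt_jac_self hW h.smooth (fun y ↦ h.jac_x_eq_zero hW hr) hz
  have heq := (((coord .D).hasFDerivAt.mul hKK).mul hX).unique
    ((hasFDerivAt_coord_comp hφ .D).congr_of_eventuallyEq <| Filter.eventually_of_mem
      (hW.mem_nhds hz) fun y hy ↦ h.jac_K_self_mul_jac_x_self hW hr hy)
  have := DFunLike.congr_fun heq (vec .x)
  have hprod : coord .D z * jac φ .K .K z = 0 ∨ hess φ .x z = 0 := by
    simpa [coord_vec_self, coord_vec_of_ne, ← jac.eq_def, hmixed, h.jac_D_eq_zero hW hr hz]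
      using this
  exact hprod.resolve_left fun hzero ↦ hD (by rw [← hrel, hzero, zero_mul])

theorem hess_D_eq_zero : hess φ .D z = 0 := by
  have hrow (y : Ext) (hy : y ∈ W) : ∀ j ≠ .D, jac φ .D j y = 0 := h.jac_D_eq_zero hW hr hy
  have heq := ((coord .D).hasFDerivAt.mul
    (hasFDerivAt_jac_self hW h.smooth hrow hz)).unique
    ((hasFDerivAt_coord_comp (h.contDiffAt hW hz) .D).congr_of_eventuallyEq <|
      Filter.eventually_of_mem (hW.mem_nhds hz) fun y hy ↦ (h.diffusion hW hr hy).2.1)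
  have := DFunLike.congr_fun heq (vec .D)
  have hprod : coord .D z = 0 ∨ hess φ .D z = 0 := by
    simpa [coord_vec_self, ← jac.eq_def] using this
  exact hprod.resolve_left (hr hz).2

end Constants

end IsEquivalence

theorem exists_eq_affine {φ : Ext → Ext} {W : Set Ext} {i : Coord} (hW : IsOpen W)
    (hconn : IsPreconnected W) (hφ : ContDiffOn ℝ ∞ φ W)
    (hrow : ∀ z ∈ W, ∀ j ≠ i, jac φ i j z = 0) (hhess : ∀ z ∈ W, hess φ i z = 0) :
    ∃ c d : ℝ, ∀ z ∈ W, jac φ i i z = c ∧ coord i (φ z) = c * coord i z + d := by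
  have hjac (z : Ext) (hz : z ∈ W) := hasFDerivAt_jac_self hW hφ hrow hz
  obtain ⟨c, hc⟩ := hW.exists_is_const_of_fderiv_eq_zero hconn
    (fun z hz ↦ (hjac z hz).differentiableAt.differentiableWithinAt)
    (fun z hz ↦ by rw [(hjac z hz).fderiv, hhess z hz]; exact zero_smul ℝ (coord i))
  have hcoord (z : Ext) (hz : z ∈ W) := hasFDerivAt_coord_comp (hφ.contDiffAt (hW.mem_nhds hz)) i
  obtain ⟨d, hd⟩ := hW.exists_eq_add_of_fderiv_eq (g := c • coord i) hconn
    (fun z hz ↦ (hcoord z hz).differentiableAt.differentiableWithinAt)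
    (c • coord i).differentiable.differentiableOn fun z hz ↦ by
      rw [(hcoord z hz).fderiv, (c • coord i).fderiv]
      exact ContinuousLinearMap.ext fun v ↦
        (coord_fderiv (hrow z hz) v).trans (by rw [hc z hz, mul_comm]; rfl)
  exact ⟨c, d, fun z hz ↦ ⟨hc z hz, hd hz⟩⟩

/-- The parameters of a transformation `t̃ = T t + τ`, `x̃ = X x + ξ`, `ũ = U u + υ`,
`f̃ = a T X⁻² f`, `D̃ = a D`, `K̃ = a X⁻¹ K`. -/
structure Scaling where
  T : ℝˣ
  X : ℝˣ
  U : ℝˣ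
  a : ℝˣ
  τ : ℝ
  ξ : ℝ
  υ : ℝ

namespace Scaling

/-- The transformation of `(t, x, u)` with given parameters. -/
def base (s : Scaling) : Equiv.Perm Base where
  toFun p := (s.T * p.1 + s.τ, s.X * p.2.1 + s.ξ, s.U * p.2.2 + s.υ)
  invFun p := ((p.1 - s.τ) / s.T, (p.2.1 - s.ξ) / s.X, (p.2.2 - s.υ) / s.U)
  left_inv p := by simp
  right_inv p := by simp [mul_div_cancel₀]

/-- The linear transformation of `(f, D, K)` with given parameters. -/
def fiber (s : Scaling) : Equiv.Perm (ℝ × ℝ × ℝ) where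
  toFun e := (s.a * s.T / s.X ^ 2 * e.1, s.a * e.2.1, s.a / s.X * e.2.2)
  invFun e := (e.1 / (s.a * s.T / s.X ^ 2), e.2.1 / s.a, e.2.2 / (s.a / s.X))
  left_inv e := by simp
  right_inv e := by simp [mul_div_cancel₀]

/-- The transformation of the extended space with given parameters. -/
def perm (s : Scaling) : Equiv.Perm Ext := s.base.prodCongr s.fiber

end Scaling

theorem IsEquivalence.exists_scaling {φ : Ext → Ext} {W : Set Ext} (h : IsEquivalence φ W)
    (hW : IsOpen W) (hconn : IsConnected W) (hr : W ⊆ regular) :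
    ∃ s : Scaling, Set.EqOn φ s.perm W := by
  obtain ⟨T, τ, hT⟩ := exists_eq_affine hW hconn.isPreconnected h.smooth
    (fun z ↦ h.jac_t_eq_zero hW hr) (fun z ↦ h.hess_t_eq_zero hW hr)
  obtain ⟨X, ξ, hX⟩ := exists_eq_affine hW hconn.isPreconnected h.smooth
    (fun z ↦ h.jac_x_eq_zero hW hr) (fun z ↦ h.hess_x_eq_zero hW hr)
  obtain ⟨U, υ, hU⟩ := exists_eq_affine hW hconn.isPreconnected h.smooth
    (fun z ↦ h.jac_u_eq_zero hW hr) (fun z ↦ h.hess_u_eq_zero hW hr)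
  obtain ⟨a, _, ha⟩ := exists_eq_affine hW hconn.isPreconnected h.smooth
    (fun z ↦ h.jac_D_eq_zero hW hr) (fun z ↦ h.hess_D_eq_zero hW hr)
  have hD (z : Ext) (hz : z ∈ W) : coord .D (φ z) = a * coord .D z := by
    rw [← (h.diffusion hW hr hz).2.1, (ha z hz).1, mul_comm]
  obtain ⟨w, hw⟩ := hconn.nonempty
  have hT₀ : T ≠ 0 := (hT w hw).1 ▸ h.jac_t_self_ne_zero hW hr hw
  have hX₀ : X ≠ 0 := (hX w hw).1 ▸ (h.jac_x_row hW hr hw).1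
  have hU₀ : U ≠ 0 := (hU w hw).1 ▸ (h.jac_u_row hW hr hw).1
  have ha₀ : a ≠ 0 := left_ne_zero_of_mul <|
    (hD w hw).symm.trans_ne (h.apply_mem_regular hw (hr hw)).2
  refine ⟨⟨.mk0 T hT₀, .mk0 X hX₀, .mk0 U hU₀, .mk0 a ha₀, τ, ξ, υ⟩, fun z hz ↦ ext_coord ?_⟩
  have hDz : coord .D z ≠ 0 := (hr hz).2
  have hf : coord .f (φ z) = a * T / X ^ 2 * coord .f z := by
    have := h.leading hW hr hz
    rw [(hT z hz).1, (hX z hz).1, hD z hz] at this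
    field_simp
    exact mul_right_cancel₀ hDz (by linear_combination -this)
  have hK : coord .K (φ z) = a / X * coord .K z := by
    have := h.convection hW hr hz
    rw [h.hess_x_eq_zero hW hr hz, (hX z hz).1, hD z hz] at this
    field_simp
    exact mul_right_cancel₀ (mul_ne_zero hDz hX₀) (by linear_combination -this)
  rintro (_ | _ | _)
  exacts [(hT z hz).2, (hX z hz).2, (hU z hz).2, hf, hD z hz, hK]

section ScalingsAreEquivalences

theorem mul_deriv_of_eventually_eq_affine {g g' : ℝ → ℝ} {b c d e x : ℝ}
    (h : ∀ᶠ y in 𝓝 x, g' (c * y + d) = b * g y + e) :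
    c * deriv g' (c * x + d) = b * deriv g x := by
  have hcomp : deriv (fun y ↦ g' (c * y + d)) x = c * deriv g' (c * x + d) := by
    rw [deriv_comp_mul_left c (fun y ↦ g' (y + d)) x, deriv_comp_add_const, smul_eq_mul]
  rw [← hcomp, Filter.EventuallyEq.deriv_eq h, deriv_add_const, deriv_const_mul_field]

theorem bijective_fderiv_of_differentiable {E F : Type*} [NormedAddCommGroup E] [NormedSpace ℝ E]
    [NormedAddCommGroup F] [NormedSpace ℝ F] (e : E ≃ F) (he : Differentiable ℝ e)
    (he' : Differentiable ℝ e.symm) (p : E) : Function.Bijective (fderiv ℝ e p) := by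
  have hleft : fderiv ℝ e.symm (e p) ∘L fderiv ℝ e p = .id ℝ E := by
    rw [← fderiv_comp p (he' _) (he _), e.symm_comp_self, fderiv_id]
  have hright : fderiv ℝ e p ∘L fderiv ℝ e.symm (e p) = .id ℝ F := by
    have := fderiv_comp (e p) (he _) (he' _)
    rwa [e.symm_apply_apply, e.self_comp_symm, fderiv_id, eq_comm] at this
  exact Function.bijective_iff_has_inverse.2
    ⟨_, DFunLike.congr_fun hleft, DFunLike.congr_fun hright⟩

/-- The image of an equation of the class under a scaling. -/
def Equation.scale (θ : Equation) (s : Scaling) : Equation where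
  I := (fun x ↦ (x - s.ξ) / s.X) ⁻¹' θ.I
  J := (fun u ↦ (u - s.υ) / s.U) ⁻¹' θ.J
  f x := s.a * s.T / s.X ^ 2 * θ.f ((x - s.ξ) / s.X)
  D u := s.a * θ.D ((u - s.υ) / s.U)
  K u := s.a / s.X * θ.K ((u - s.υ) / s.U)
  isOpen_I := θ.isOpen_I.preimage (by fun_prop)
  isOpen_J := θ.isOpen_J.preimage (by fun_prop)
  isPreconnected_I :=
    (affineHomeomorph _ s.ξ s.X.ne_zero).symm.isPreconnected_preimage.2 θ.isPreconnected_I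
  isPreconnected_J :=
    (affineHomeomorph _ s.υ s.U.ne_zero).symm.isPreconnected_preimage.2 θ.isPreconnected_J
  smooth_f := contDiffOn_const.mul (θ.smooth_f.comp (t := θ.I) (by fun_prop) fun _ hx ↦ hx)
  smooth_D := contDiffOn_const.mul (θ.smooth_D.comp (t := θ.J) (by fun_prop) fun _ hx ↦ hx)
  smooth_K := contDiffOn_const.mul (θ.smooth_K.comp (t := θ.J) (by fun_prop) fun _ hx ↦ hx)
  f_ne_zero x hx := mul_ne_zero (by simp) (θ.f_ne_zero _ hx)
  D_ne_zero u hu := mul_ne_zero s.a.ne_zero (θ.D_ne_zero _ hu)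
  nonlinear := by
    obtain ⟨u, hu, h⟩ := θ.nonlinear
    have hderiv (c : ℝ) (g : ℝ → ℝ) :
        s.U * deriv (fun y ↦ c * g ((y - s.υ) / s.U)) (s.U * u + s.υ) = c * deriv g u :=
      mul_deriv_of_eventually_eq_affine (e := 0) (.of_forall fun y ↦ by simp)
    refine ⟨s.U * u + s.υ, by simpa using hu, h.imp (fun hD h₀ ↦ hD ?_) (fun hK h₀ ↦ hK ?_)⟩
    · simpa [h₀] using hderiv s.a θ.D
    · simpa [h₀] using hderiv (s.a / s.X) θ.K

theorem Equation.holdsAt_scale_iff (θ : Equation) (s : Scaling) {v v' : ℝ × ℝ → ℝ} {p : ℝ × ℝ}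
    (h : ∀ᶠ q in 𝓝 p, v' (s.T * q.1 + s.τ, s.X * q.2 + s.ξ) = s.U * v q + s.υ) :
    (θ.scale s).HoldsAt v' (s.T * p.1 + s.τ, s.X * p.2 + s.ξ) ↔ θ.HoldsAt v p := by
  obtain ⟨t, x⟩ := p
  have ht : ∀ᶠ r in 𝓝 t, v' (s.T * r + s.τ, s.X * x + s.ξ) = s.U * v (r, x) + s.υ :=
    (Continuous.prodMk_left x).continuousAt.eventually h
  have hx : ∀ᶠ y in 𝓝 x, v' (s.T * t + s.τ, s.X * y + s.ξ) = s.U * v (t, y) + s.υ :=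
    (Continuous.prodMk_right t).continuousAt.eventually h
  have hvt := mul_deriv_of_eventually_eq_affine (g := fun r ↦ v (r, x))
    (g' := fun r ↦ v' (r, s.X * x + s.ξ)) ht
  have hvx : ∀ᶠ y in 𝓝 x, s.X * deriv (fun y ↦ v' (s.T * t + s.τ, y)) (s.X * y + s.ξ) =
      s.U * deriv (fun y ↦ v (t, y)) y :=
    hx.eventually_nhds.mono fun _ ↦ mul_deriv_of_eventually_eq_affine
      (g := fun y ↦ v (t, y)) (g' := fun y ↦ v' (s.T * t + s.τ, y))
  have hflux := mul_deriv_of_eventually_eq_affine (e := 0) (b := s.a * s.U / s.X)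
    (g := fun y ↦ θ.D (v (t, y)) * deriv (fun y ↦ v (t, y)) y)
    (g' := fun y ↦ (θ.scale s).D (v' (s.T * t + s.τ, y))
      * deriv (fun y ↦ v' (s.T * t + s.τ, y)) y) <| by
    filter_upwards [hx, hvx] with y hy hvy
    rw [hy]
    simp only [Equation.scale, add_sub_cancel_right]
    field_simp
    linear_combination s.a * θ.D (v (t, y)) * hvy
  have hf : (θ.scale s).f (s.X * x + s.ξ) = s.a * s.T / s.X ^ 2 * θ.f x := by
    simp [Equation.scale]
  have hK : (θ.scale s).K (v' (s.T * t + s.τ, s.X * x + s.ξ)) = s.a / s.X * θ.K (v (t, x)) := by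
    rw [hx.self_of_nhds]
    simp [Equation.scale]
  refine Iff.trans (Eq.congr ?_ ?_) (mul_right_inj' (a := (s.a * s.U / s.X ^ 2 : ℝ)) (by simp))
  · rw [hf]
    field_simp
    linear_combination θ.f x * hvt
  · rw [hK, ← mul_right_inj' s.X.ne_zero, mul_add, hflux]
    field_simp
    linear_combination θ.K (v (t, x)) * hvx.self_of_nhds

namespace Scaling

variable (s : Scaling)

theorem bijective_fderiv_base (p : Base) : Function.Bijective (fderiv ℝ s.base p) :=
  bijective_fderiv_of_differentiable s.base
    (show Differentiable ℝ fun p : Base ↦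
      (s.T * p.1 + s.τ, s.X * p.2.1 + s.ξ, s.U * p.2.2 + s.υ) by fun_prop)
    (show Differentiable ℝ fun p : Base ↦
      ((p.1 - s.τ) / s.T, (p.2.1 - s.ξ) / s.X, (p.2.2 - s.υ) / s.U) by fun_prop) p

theorem mapsEquationAt_perm {θ : Equation} {p : Base} (hp : p ∈ θ.dom) :
    MapsEquationAt s.perm θ (θ.scale s) p where
  nonsingular := s.bijective_fderiv_base p
  mem_dom := by simpa [Equation.dom, Equation.scale, induced, perm, base, Equation.lift] using hp
  map_lift := by simp [induced, perm, base, fiber, Equation.lift, Equation.scale]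
  holds_iff _ _ _ _ _ h := (θ.holdsAt_scale_iff s h).symm

theorem contDiff_perm : ContDiff ℝ ∞ s.perm :=
  show ContDiff ℝ ∞ fun z : Ext ↦
    ((s.T * z.1.1 + s.τ, s.X * z.1.2.1 + s.ξ, s.U * z.1.2.2 + s.υ),
      (s.a * s.T / s.X ^ 2 * z.2.1, s.a * z.2.2.1, s.a / s.X * z.2.2.2)) by fun_prop

theorem contDiff_perm_symm : ContDiff ℝ ∞ s.perm.symm :=
  show ContDiff ℝ ∞ fun z : Ext ↦
    (((z.1.1 - s.τ) / s.T, (z.1.2.1 - s.ξ) / s.X, (z.1.2.2 - s.υ) / s.U),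
      (z.2.1 / (s.a * s.T / s.X ^ 2), z.2.2.1 / s.a, z.2.2.2 / (s.a / s.X))) by fun_prop

theorem isEquivalence_perm (W : Set Ext) : IsEquivalence s.perm W where
  smooth := s.contDiff_perm.contDiffOn
  injOn := s.perm.injective.injOn
  bijective_fderiv z _ := bijective_fderiv_of_differentiable s.perm
    (s.contDiff_perm.differentiable (by simp)) (s.contDiff_perm_symm.differentiable (by simp)) z
  maps_class θ _ hp _ := ⟨θ.scale s, Filter.eventually_of_mem (θ.isOpen_dom.mem_nhds hp)
    fun _ hq ↦ s.mapsEquationAt_perm hq⟩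

end Scaling

end ScalingsAreEquivalences

section Classification

theorem MapsEquationAt.congr {φ φ' : Ext → Ext} {θ θ' : Equation} {p : Base}
    (h : MapsEquationAt φ θ θ' p) (hp : p ∈ θ.dom) (heq : φ' =ᶠ[𝓝 (θ.lift p)] φ) :
    MapsEquationAt φ' θ θ' p := by
  have hind : induced φ' θ =ᶠ[𝓝 p] induced φ θ :=
    ((Equation.contDiffAt_lift hp).continuousAt.eventually heq).mono fun _ ↦ congrArg Prod.fst
  have hindp := hind.self_of_nhds
  refine ⟨?_, ?_, ?_, fun v v' hvp hv hv' hgraph ↦ ?_⟩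
  · rw [hind.fderiv_eq]
    exact h.nonsingular
  · rw [hindp]
    exact h.mem_dom
  · rw [hindp, heq.self_of_nhds]
    exact h.map_lift
  · rw [hindp] at hv' ⊢
    have hp : graph v (p.1, p.2.1) = p := by simp [graph, hvp]
    refine h.holds_iff v v' hvp hv hv' ?_
    filter_upwards [hgraph, (contDiffAt_graph hv).continuousAt.eventually (hp.symm ▸ hind)]
      with s hs hinds
    rw [graph] at hinds
    rwa [hinds] at hs

namespace IsEquivalence

variable {φ φ' : Ext → Ext} {V W : Set Ext}

theorem congr (h : IsEquivalence φ W) (hW : IsOpen W) (heq : Set.EqOn φ' φ W) :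
    IsEquivalence φ' W where
  smooth := h.smooth.congr heq
  injOn := h.injOn.congr heq.symm
  bijective_fderiv z hz := by
    rw [(heq.eventuallyEq_of_mem (hW.mem_nhds hz)).fderiv_eq]
    exact h.bijective_fderiv z hz
  maps_class θ p hp hpW := by
    obtain ⟨θ', hθ'⟩ := h.maps_class θ p hp hpW
    refine ⟨θ', ?_⟩
    filter_upwards [hθ', θ.isOpen_dom.mem_nhds hp,
      (Equation.contDiffAt_lift hp).continuousAt.preimage_mem_nhds (hW.mem_nhds hpW)]
      with q hq hqdom hqW
    exact hq.congr hqdom (heq.eventuallyEq_of_mem (hW.mem_nhds hqW))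

theorem mono (h : IsEquivalence φ W) (hVW : V ⊆ W) : IsEquivalence φ V where
  smooth := h.smooth.mono hVW
  injOn := h.injOn.mono hVW
  bijective_fderiv z hz := h.bijective_fderiv z (hVW hz)
  maps_class θ p hp hpV := h.maps_class θ p hp (hVW hpV)

end IsEquivalence

namespace Scaling

instance : One Scaling := ⟨⟨1, 1, 1, 1, 0, 0, 0⟩⟩

theorem perm_one : perm 1 = 1 :=
  show perm ⟨1, 1, 1, 1, 0, 0, 0⟩ = 1 from Equiv.ext fun z ↦ by simp [perm, base, fiber]

theorem perm_mul (s s' : Scaling) : s.perm * s'.perm =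
    perm ⟨s.T * s'.T, s.X * s'.X, s.U * s'.U, s.a * s'.a, s.T * s'.τ + s.τ, s.X * s'.ξ + s.ξ,
      s.U * s'.υ + s.υ⟩ :=
  Equiv.ext fun z ↦ ext_coord fun i ↦ by
    cases i <;> simp [coord, perm, base, fiber] <;> ring

theorem perm_inv (s : Scaling) : s.perm⁻¹ =
    perm ⟨s.T⁻¹, s.X⁻¹, s.U⁻¹, s.a⁻¹, -s.T⁻¹ * s.τ, -s.X⁻¹ * s.ξ, -s.U⁻¹ * s.υ⟩ := by
  refine inv_eq_of_mul_eq_one_right ?_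
  rw [perm_mul]
  refine Equiv.ext fun z ↦ ext_coord fun i ↦ ?_
  cases i <;> simp [coord, perm, base, fiber]

/-- The group of the transformations `Scaling.perm`, shown below to be `generatedGroup`. -/
def group : Subgroup (Equiv.Perm Ext) where
  carrier := Set.range perm
  one_mem' := ⟨1, perm_one⟩
  mul_mem' := by
    rintro _ _ ⟨s, rfl⟩ ⟨s', rfl⟩
    exact ⟨_, (s.perm_mul s').symm⟩
  inv_mem' := by
    rintro _ ⟨s, rfl⟩
    exact ⟨_, s.perm_inv.symm⟩

end Scaling

theorem continuousTransformation_eq_perm (ε₁ ε₂ ε₃ ε₄ ε₅ ε₆ ε₇ : ℝ) :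
    continuousTransformation ε₁ ε₂ ε₃ ε₄ ε₅ ε₆ ε₇ =
      Scaling.perm ⟨.mk0 _ (Real.exp_ne_zero ε₄), .mk0 _ (Real.exp_ne_zero ε₅),
        .mk0 _ (Real.exp_ne_zero ε₆), .mk0 _ (Real.exp_ne_zero ε₇), ε₁, ε₂, ε₃⟩ := by
  refine Equiv.ext fun z ↦ ext_coord fun i ↦ ?_
  cases i <;> simp [coord, Scaling.perm, Scaling.base, Scaling.fiber, continuousTransformation,
    Real.exp_add, Real.exp_sub, Real.exp_neg, two_mul] <;> field_simp

theorem signTDK_eq_perm : signTDK = Scaling.perm ⟨-1, 1, 1, -1, 0, 0, 0⟩ :=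
  Equiv.ext fun z ↦ ext_coord fun i ↦ by
    cases i <;> simp [coord, signTDK, Scaling.perm, Scaling.base, Scaling.fiber]

theorem signXK_eq_perm : signXK = Scaling.perm ⟨1, -1, 1, 1, 0, 0, 0⟩ :=
  Equiv.ext fun z ↦ ext_coord fun i ↦ by
    cases i <;> simp [coord, signXK, Scaling.perm, Scaling.base, Scaling.fiber]

theorem signU_eq_perm : signU = Scaling.perm ⟨1, 1, -1, 1, 0, 0, 0⟩ :=
  Equiv.ext fun z ↦ ext_coord fun i ↦ by
    cases i <;> simp [coord, signU, Scaling.perm, Scaling.base, Scaling.fiber]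

theorem signFDK_eq_perm : signFDK = Scaling.perm ⟨1, 1, 1, -1, 0, 0, 0⟩ :=
  Equiv.ext fun z ↦ ext_coord fun i ↦ by
    cases i <;> simp [coord, signFDK, Scaling.perm, Scaling.base, Scaling.fiber]

theorem signs_subset_generatedGroup :
    {signTDK, signXK, signU, signFDK} ⊆ (generatedGroup : Set _) :=
  Set.subset_union_right.trans Subgroup.subset_closure

theorem Scaling.perm_mem_generatedGroup_of_pos (s : Scaling) (hT : 0 < (s.T : ℝ))
    (hX : 0 < (s.X : ℝ)) (hU : 0 < (s.U : ℝ)) (ha : 0 < (s.a : ℝ)) :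
    s.perm ∈ generatedGroup := by
  refine Subgroup.subset_closure (.inl ⟨s.τ, s.ξ, s.υ, .log s.T, .log s.X, .log s.U, .log s.a, ?_⟩)
  simp [continuousTransformation_eq_perm, Real.exp_log, hT, hX, hU, ha]

theorem Scaling.perm_mem_generatedGroup (s : Scaling) : s.perm ∈ generatedGroup := by
  have cancel {σ : Equiv.Perm Ext} (hσ : σ ∈ ({signTDK, signXK, signU, signFDK} : Set _))
      {s : Scaling} (hs : σ * s.perm ∈ generatedGroup) : s.perm ∈ generatedGroup :=
    (Subgroup.mul_mem_cancel_left _ (signs_subset_generatedGroup hσ)).1 hs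
  wlog hT : 0 < (s.T : ℝ) generalizing s
  · refine cancel (σ := signTDK) (by simp) ?_
    rw [signTDK_eq_perm, perm_mul]
    exact this _ (by simpa using lt_of_le_of_ne (not_lt.1 hT) s.T.ne_zero)
  wlog hX : 0 < (s.X : ℝ) generalizing s
  · refine cancel (σ := signXK) (by simp) ?_
    rw [signXK_eq_perm, perm_mul]
    exact this _ (by simpa using hT)
      (by simpa using lt_of_le_of_ne (not_lt.1 hX) s.X.ne_zero)
  wlog hU : 0 < (s.U : ℝ) generalizing s
  · refine cancel (σ := signU) (by simp) ?_
    rw [signU_eq_perm, perm_mul]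
    exact this _ (by simpa using hT) (by simpa using hX)
      (by simpa using lt_of_le_of_ne (not_lt.1 hU) s.U.ne_zero)
  wlog ha : 0 < (s.a : ℝ) generalizing s
  · refine cancel (σ := signFDK) (by simp) ?_
    rw [signFDK_eq_perm, perm_mul]
    exact this _ (by simpa using hT) (by simpa using hX) (by simpa using hU)
      (by simpa using lt_of_le_of_ne (not_lt.1 ha) s.a.ne_zero)
  exact s.perm_mem_generatedGroup_of_pos hT hX hU ha

theorem generatedGroup_eq : generatedGroup = Scaling.group := by
  refine le_antisymm ((Subgroup.closure_le _).2 ?_) ?_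
  · rintro _ (⟨ε₁, ε₂, ε₃, ε₄, ε₅, ε₆, ε₇, rfl⟩ | rfl | rfl | rfl | rfl)
    exacts [⟨_, (continuousTransformation_eq_perm ..).symm⟩, ⟨_, signTDK_eq_perm.symm⟩,
      ⟨_, signXK_eq_perm.symm⟩, ⟨_, signU_eq_perm.symm⟩, ⟨_, signFDK_eq_perm.symm⟩]
  · rintro _ ⟨s, rfl⟩
    exact s.perm_mem_generatedGroup

theorem isEquivalence_iff {φ : Ext → Ext} {W : Set Ext} (hW : IsOpen W) (hconn : IsConnected W)
    (hr : W ⊆ regular) : IsEquivalence φ W ↔ ∃ ψ ∈ generatedGroup, Set.EqOn φ ψ W := by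
  rw [generatedGroup_eq]
  constructor
  · intro h
    obtain ⟨s, hs⟩ := h.exists_scaling hW hconn hr
    exact ⟨_, ⟨s, rfl⟩, hs⟩
  · rintro ⟨_, ⟨s, rfl⟩, hs⟩
    exact (s.isEquivalence_perm W).congr hW hs

end Classification

section LieAlgebra

/-- The linear combination of the vector fields `generator i` with coefficients `c`. -/
def field (c : Fin 7 → ℝ) (z : Ext) : Ext :=
  ((c 0 + c 3 * z.1.1, c 1 + c 4 * z.1.2.1, c 2 + c 5 * z.1.2.2),
    ((c 6 + c 3 - 2 * c 4) * z.2.1, c 6 * z.2.2.1, (c 6 - c 4) * z.2.2.2))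

theorem sum_generator (c : Fin 7 → ℝ) : ∑ i, c i • generator i = field c := by
  refine funext fun z ↦ ext_coord fun i ↦ ?_
  cases i <;> simp [Fin.sum_univ_seven, generator, field, coord] <;> ring

theorem mem_span_generator {R : Ext → Ext} :
    R ∈ Submodule.span ℝ (Set.range generator) ↔ ∃ c, field c = R := by
  simp only [Submodule.mem_span_range_iff_exists_fun, sum_generator]

theorem contDiff_field (c : Fin 7 → ℝ) : ContDiff ℝ ω (field c) := by
  unfold field
  fun_prop

/-- At the time `ε`, the curve `s` of scalings moves with the velocity field `field c`. -/
structure Scaling.HasVelocityAt (s : ℝ → Scaling) (c : Fin 7 → ℝ) (ε : ℝ) : Prop where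
  τ : HasDerivAt (fun r ↦ (s r).τ) (c 0 + c 3 * (s ε).τ) ε
  ξ : HasDerivAt (fun r ↦ (s r).ξ) (c 1 + c 4 * (s ε).ξ) ε
  υ : HasDerivAt (fun r ↦ (s r).υ) (c 2 + c 5 * (s ε).υ) ε
  T : HasDerivAt (fun r ↦ ((s r).T : ℝ)) (c 3 * (s ε).T) ε
  X : HasDerivAt (fun r ↦ ((s r).X : ℝ)) (c 4 * (s ε).X) ε
  U : HasDerivAt (fun r ↦ ((s r).U : ℝ)) (c 5 * (s ε).U) ε
  a : HasDerivAt (fun r ↦ ((s r).a : ℝ)) (c 6 * (s ε).a) ε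

namespace Scaling

variable {s : ℝ → Scaling} {c : Fin 7 → ℝ} {ε : ℝ}

theorem HasVelocityAt.hasDerivAt_perm (h : HasVelocityAt s c ε) (z : Ext) :
    HasDerivAt (fun r ↦ (s r).perm z) (field c ((s ε).perm z)) ε := by
  have hX : ((s ε).X : ℝ) ≠ 0 := (s ε).X.ne_zero
  have hbase := ((h.T.mul_const z.1.1).add h.τ).prodMk
    (((h.X.mul_const z.1.2.1).add h.ξ).prodMk ((h.U.mul_const z.1.2.2).add h.υ))
  have hf := ((h.a.fun_mul h.T).fun_div (h.X.fun_pow 2) (pow_ne_zero 2 hX)).mul_const z.2.1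
  have hfiber := hf.prodMk ((h.a.mul_const z.2.2.1).prodMk
    ((h.a.fun_div h.X hX).mul_const z.2.2.2))
  refine (hbase.prodMk hfiber).congr_deriv (ext_coord fun i ↦ ?_)
  cases i <;> simp [coord, field, perm, base, fiber] <;> field_simp <;> ring

theorem HasVelocityAt.continuousAt_perm (h : HasVelocityAt s c ε) (z : Ext) :
    ContinuousAt (fun y : ℝ × Ext ↦ (s y.1).perm y.2) (ε, z) := by
  have hX : ((s ε).X : ℝ) ≠ 0 := (s ε).X.ne_zero
  have hparam {g : ℝ → ℝ} {g' : ℝ} (hg : HasDerivAt g g' ε) :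
      ContinuousAt (fun y : ℝ × Ext ↦ g y.1) (ε, z) := hg.continuousAt.comp continuousAt_fst
  have hcoord (i : Coord) : ContinuousAt (fun y : ℝ × Ext ↦ coord i y.2) (ε, z) := by fun_prop
  have hbase := (((hparam h.T).mul (hcoord .t)).add (hparam h.τ)).prodMk
    ((((hparam h.X).mul (hcoord .x)).add (hparam h.ξ)).prodMk
      (((hparam h.U).mul (hcoord .u)).add (hparam h.υ)))
  have hf := (((hparam h.a).mul (hparam h.T)).div ((hparam h.X).pow 2)
    (pow_ne_zero 2 hX)).mul (hcoord .f)
  exact hbase.prodMk (hf.prodMk (((hparam h.a).mul (hcoord .D)).prodMk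
    (((hparam h.a).div (hparam h.X) hX).mul (hcoord .K))))

end Scaling

theorem exists_hasDerivAt_affine (c d : ℝ) :
    ∃ g : ℝ → ℝ, g 0 = 0 ∧ ∀ ε, HasDerivAt g (d + c * g ε) ε := by
  by_cases hc : c = 0
  · exact ⟨fun ε ↦ d * ε, by simp, fun ε ↦ by simpa [hc] using (hasDerivAt_id ε).const_mul d⟩
  · refine ⟨fun ε ↦ d / c * (Real.exp (c * ε) - 1), by simp, fun ε ↦ ?_⟩
    refine ((((hasDerivAt_id ε).const_mul c).exp.sub_const 1).const_mul (d / c)).congr_deriv ?_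
    simp only [id_eq]
    field_simp
    ring

theorem Scaling.exists_hasVelocityAt (c : Fin 7 → ℝ) :
    ∃ s : ℝ → Scaling, s 0 = 1 ∧ ∀ ε, HasVelocityAt s c ε := by
  obtain ⟨τ, hτ₀, hτ⟩ := exists_hasDerivAt_affine (c 3) (c 0)
  obtain ⟨ξ, hξ₀, hξ⟩ := exists_hasDerivAt_affine (c 4) (c 1)
  obtain ⟨υ, hυ₀, hυ⟩ := exists_hasDerivAt_affine (c 5) (c 2)
  have hexp (b ε : ℝ) : HasDerivAt (fun r ↦ Real.exp (b * r)) (b * Real.exp (b * ε)) ε := by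
    simpa [mul_comm] using ((hasDerivAt_id ε).const_mul b).exp
  let e (b r : ℝ) : ℝˣ := .mk0 (Real.exp (b * r)) (Real.exp_ne_zero _)
  have he (b : ℝ) : e b 0 = 1 := by ext; simp [e]
  refine ⟨fun r ↦ ⟨e (c 3) r, e (c 4) r, e (c 5) r, e (c 6) r, τ r, ξ r, υ r⟩, ?_, fun ε ↦ ?_⟩
  · simp only [he, hτ₀, hξ₀, hυ₀]
    rfl
  · exact ⟨hτ ε, hξ ε, hυ ε, hexp _ ε, hexp _ ε, hexp _ ε, hexp _ ε⟩

theorem isInfinitesimalEquivalence_of_eqOn_field {W : Set Ext} (hW : IsOpen W) {Q : Ext → Ext}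
    {c : Fin 7 → ℝ} (hQ : Set.EqOn Q (field c) W) : IsInfinitesimalEquivalence Q W where
  smooth := ((contDiff_field c).of_le le_top).contDiffOn.congr hQ
  exists_flow z₀ hz₀ := by
    obtain ⟨s, hs₀, hs⟩ := Scaling.exists_hasVelocityAt c
    have hid (z : Ext) : (s 0).perm z = z := by rw [hs₀, Scaling.perm_one]; rfl
    have hmem : (fun y : ℝ × Ext ↦ (s y.1).perm y.2) ⁻¹' W ∈ 𝓝 ((0 : ℝ), z₀) :=
      ((hs 0).continuousAt_perm z₀).preimage_mem_nhds
        (hW.mem_nhds (by simpa only [hid] using hz₀))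
    obtain ⟨u, v, hu, h0u, hv, hzv, huv⟩ := mem_nhds_prod_iff'.1 hmem
    obtain ⟨r, hr, hru⟩ := Metric.isOpen_iff.1 hu 0 h0u
    refine ⟨v ∩ W, hv.inter hW, ⟨hzv, hz₀⟩, Set.inter_subset_right, r, hr,
      fun ε ↦ (s ε).perm, fun z _ ↦ hid z, fun z hz ε hε ↦ ?_,
      fun ε _ ↦ (s ε).isEquivalence_perm _⟩
    have hin : (s ε).perm z ∈ W := huv (Set.mk_mem_prod (hru (by simpa using hε)) hz.1)
    exact ⟨hin, hQ hin ▸ (hs ε).hasDerivAt_perm z⟩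

theorem differentiableAt_of_affine {g h : ℝ → ℝ} {y₀ y₁ ε : ℝ} (hne : y₀ ≠ y₁)
    (h₀ : DifferentiableAt ℝ (fun r ↦ g r * y₀ + h r) ε)
    (h₁ : DifferentiableAt ℝ (fun r ↦ g r * y₁ + h r) ε) :
    DifferentiableAt ℝ g ε ∧ DifferentiableAt ℝ h ε := by
  have hg : DifferentiableAt ℝ g ε := by
    refine ((h₁.fun_sub h₀).div_const (y₁ - y₀)).congr_of_eventuallyEq (.of_forall fun r ↦ ?_)
    have := sub_ne_zero.2 hne.symm
    field_simp
    ring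
  refine ⟨hg, (h₀.fun_sub (hg.mul_const y₀)).congr_of_eventuallyEq (.of_forall fun r ↦ ?_)⟩
  simp

theorem Scaling.exists_hasVelocityAt_of_differentiableAt {s : ℝ → Scaling} {ε : ℝ} {z₀ z₁ : Ext}
    (hD : z₀.2.2.1 ≠ 0) (ht : z₀.1.1 ≠ z₁.1.1) (hx : z₀.1.2.1 ≠ z₁.1.2.1)
    (hu : z₀.1.2.2 ≠ z₁.1.2.2) (h₀ : DifferentiableAt ℝ (fun r ↦ (s r).perm z₀) ε)
    (h₁ : DifferentiableAt ℝ (fun r ↦ (s r).perm z₁) ε) : ∃ c, HasVelocityAt s c ε := by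
  have hcoord {z : Ext} (h : DifferentiableAt ℝ (fun r ↦ (s r).perm z) ε) (i : Coord) :
      DifferentiableAt ℝ (fun r ↦ coord i ((s r).perm z)) ε :=
    (coord i).differentiableAt.comp ε h
  obtain ⟨hT, hτ⟩ := differentiableAt_of_affine ht (hcoord h₀ .t) (hcoord h₁ .t)
  obtain ⟨hX, hξ⟩ := differentiableAt_of_affine hx (hcoord h₀ .x) (hcoord h₁ .x)
  obtain ⟨hU, hυ⟩ := differentiableAt_of_affine hu (hcoord h₀ .u) (hcoord h₁ .u)
  have ha : DifferentiableAt ℝ (fun r ↦ ((s r).a : ℝ)) ε :=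
    ((hcoord h₀ .D).div_const z₀.2.2.1).congr_of_eventuallyEq
      (.of_forall fun r ↦ (mul_div_cancel_right₀ _ hD).symm)
  have hlinear {g : ℝ → ℝ} (hg : DifferentiableAt ℝ g ε) (hg₀ : g ε ≠ 0) :
      HasDerivAt g (deriv g ε / g ε * g ε) ε := by
    rw [div_mul_cancel₀ _ hg₀]
    exact hg.hasDerivAt
  have haffine {g : ℝ → ℝ} (hg : DifferentiableAt ℝ g ε) (k : ℝ) :
      HasDerivAt g (deriv g ε - k * g ε + k * g ε) ε := by
    rw [sub_add_cancel]
    exact hg.hasDerivAt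
  exact ⟨![_, _, _, _, _, _, _], haffine hτ _, haffine hξ _, haffine hυ _,
    hlinear hT (s ε).T.ne_zero, hlinear hX (s ε).X.ne_zero, hlinear hU (s ε).U.ne_zero,
    hlinear ha (s ε).a.ne_zero⟩

theorem IsInfinitesimalEquivalence.eventuallyEq_field {W : Set Ext} (hr : W ⊆ regular)
    {Q : Ext → Ext} (h : IsInfinitesimalEquivalence Q W) {z₀ : Ext} (hz₀ : z₀ ∈ W) :
    ∃ c, Q =ᶠ[𝓝 z₀] field c := by
  obtain ⟨V, hV, hzV, hVW, r, hr₀, Φ, hΦ₀, hΦ, hΦe⟩ := h.exists_flow z₀ hz₀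
  obtain ⟨ρ, hρ, hball⟩ := Metric.isOpen_iff.1 hV z₀ hzV
  have hconn : IsConnected (Metric.ball z₀ ρ) :=
    (convex_ball z₀ ρ).isConnected ⟨z₀, Metric.mem_ball_self hρ⟩
  have hscaling (ε : ℝ) (hε : |ε| < r) :
      ∃ s : Scaling, Set.EqOn (Φ ε) s.perm (Metric.ball z₀ ρ) :=
    ((hΦe ε hε).mono hball).exists_scaling Metric.isOpen_ball hconn
      (hball.trans (hVW.trans hr))
  choose! s hs using hscaling
  have hr₀' : |(0 : ℝ)| < r := by rwa [abs_zero]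
  have hderiv (z : Ext) (hz : z ∈ Metric.ball z₀ ρ) :
      HasDerivAt (fun ε ↦ (s ε).perm z) (Q z) 0 := by
    have := (hΦ z (hball hz) 0 hr₀').2
    rw [hΦ₀ z (hball hz)] at this
    exact this.congr_of_eventuallyEq <| (continuous_abs.continuousAt.eventually_lt_const hr₀').mono
      fun ε hε ↦ (hs ε hε hz).symm
  have hz₁ : z₀ + ((ρ / 2, ρ / 2, ρ / 2), 0) ∈ Metric.ball z₀ ρ := by
    simp [Prod.norm_def, abs_of_pos hρ, hρ]
  have hz₀ball := Metric.mem_ball_self (x := z₀) hρ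
  obtain ⟨c, hc⟩ := Scaling.exists_hasVelocityAt_of_differentiableAt (hr hz₀).2
    (by simp [hρ.ne']) (by simp [hρ.ne']) (by simp [hρ.ne'])
    (hderiv z₀ hz₀ball).differentiableAt (hderiv _ hz₁).differentiableAt
  refine ⟨c, Filter.eventually_of_mem (Metric.ball_mem_nhds z₀ hρ) fun z hz ↦ ?_⟩
  have hid : (s 0).perm z = z := (hs 0 hr₀' hz).symm.trans (hΦ₀ z (hball hz))
  exact ((hderiv z hz).unique (hc.hasDerivAt_perm z)).trans (congrArg (field c) hid)

theorem isInfinitesimalEquivalence_iff {Q : Ext → Ext} {W : Set Ext} (hW : IsOpen W)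
    (hconn : IsConnected W) (hr : W ⊆ regular) :
    IsInfinitesimalEquivalence Q W ↔
      ∃ R ∈ Submodule.span ℝ (Set.range generator), Set.EqOn Q R W := by
  constructor
  · intro h
    obtain ⟨z₀, hz₀⟩ := hconn.nonempty
    obtain ⟨c, hQ⟩ := h.eventuallyEq_field hr hz₀
    refine ⟨field c, mem_span_generator.2 ⟨c, rfl⟩, ?_⟩
    have hanalytic : AnalyticOnNhd ℝ Q W := fun z hz ↦
      let ⟨c', hc'⟩ := h.eventuallyEq_field hr hz
      ((contDiff_field c').analyticOnNhd z hz).congr hc'.symm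
    exact hanalytic.eqOn_of_preconnected_of_eventuallyEq (contDiff_field c).analyticOnNhd
      hconn.isPreconnected hz₀ hQ
  · rintro ⟨R, hR, hQ⟩
    obtain ⟨c, rfl⟩ := mem_span_generator.1 hR
    exact isInfinitesimalEquivalence_of_eqOn_field hW hQ

end LieAlgebra

end DiffConv

end

theorem theorem2 (W : Set DiffConv.Ext) (hW_open : IsOpen W) (hW_conn : IsConnected W)
    (hW_reg : W ⊆ DiffConv.regular) :
    (∀ Q : DiffConv.Ext → DiffConv.Ext,
      DiffConv.IsInfinitesimalEquivalence Q W ↔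
        ∃ R ∈ Submodule.span ℝ (Set.range DiffConv.generator), Set.EqOn Q R W) ∧
    (∀ φ : DiffConv.Ext → DiffConv.Ext,
      DiffConv.IsEquivalence φ W ↔
        ∃ ψ ∈ DiffConv.generatedGroup, Set.EqOn φ ψ W) :=
  ⟨fun _ ↦ DiffConv.isInfinitesimalEquivalence_iff hW_open hW_conn hW_reg,
    fun _ ↦ DiffConv.isEquivalence_iff hW_open hW_conn hW_reg⟩
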